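/- **Model.** Fix $d\ge 1$, $K\ge 1$, radii $0=R_0<R_1<\dots<R_K=R_\infty<\infty$, exponents $\beta_0\ge 0$, $\beta_k\ge d-1$ for $1\le k\le K-1$, $\beta_k<\beta_{k+1}<\infty$, and constants $A_k>0$ with $A_kR_{k+1}^{\beta_k}=A_{k+1}R_{k+1}^{\beta_{k+1}}$ for $0\le k\le K-2$. The pathloss function is $l(r)=\sum_{k=0}^{K-1}A_kr^{\beta_k}\mathbf 1(R_k\le r<R_{k+1})$. For a density $\lambda\ge 0$ let the nodes $x_i$ form a homogeneous Poisson point process of intensity $\lambda$ on the ball of radius $R_\infty$ around the origin of $\mathbb R^d$, independently marked by i.i.d. channel powers $m_i\ge 0$ with law $F_m$, not almost surely zero. The user at the origin receives $P_i=m_i/l(\|x_i\|)$ from node $i$. With noise power $0<W<\infty$ put $Q_i=P_i/(\sum_{j\ne i}P_j+W)$ and $\mathrm{SINR}=\max_iQ_i$ ($0$ if there is no node). For a target $y>0$ let $$\mathcal P_y(\lambda)=\mathbb P(\mathrm{SINR}\ge y),\qquad \mathcal C(\lambda)=\mathbb E\log(1+\mathrm{SINR})\in[0,\infty].$$ Let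 $P=m/l(\|x\|)$ be the received power from a random node ($x$ uniform on the ball, $m\sim F_m$ independent of $x$), and $\bar F_P(t)=\mathbb P(P>t)$. For $\rho\in\mathbb R$, $\mathcal R_\rho$ is the class of positive Lebesgue measurable $h$ on $(0,\infty)$ with $h(tx)/h(x)\to t^\rho$ as $x\to\infty$ for all $t>0$; $\mathcal R_{-\infty}$ is the class of those with $h(tx)/h(x)\to 0$ for $t>1$ and $\to\infty$ for $0<t<1$. **Theorem.** 1. If $\bar F_P\in\mathcal R_0$, then $\mathcal P_y(\lambda)\to1$ and $\mathcal C(\lambda)\to\infty$ as $\lambda\to\infty$. 2. If $\bar F_P\in\mathcal R_{-\alpha}$ with $0<\alpha<1$, then for every $0<u<\infty$, $\mathcal P_y(u\lambda)/\mathcal P_y(\lambda)\to1$ and $\mathcal C(u\lambda)/\mathcal C(\lambda)\to1$ as $\lambda\to\infty$. 3. Suppose that $\bar F_P\notin\mathcal R_{-\alpha}$ for all $\alpha\in[0,1]$, and that either $\bar F_P\in\mathcal R_{-\rho}$ for some $\rho\in[0,\infty]$, or $\bar F_P=o(\bar H)$ for the tail $\bar H\in\mathcal R_{-\infty}$ of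 some probability distribution, or $\mathbb E P<\infty$. Then $\mathcal P_y(\lambda)\to0$ and $\mathcal C(\lambda)\to0$ as $\lambda\to\infty$; there is a finite density $\lambda_c$ with $\mathcal C(\lambda_c)>0=\lim_{\lambda\to\infty}\mathcal C(\lambda)$; and, provided that $\mathbb P(P\ge yW)>0$, there is a finite density $\lambda_p$ with $\mathcal P_y(\lambda_p)>0=\lim_{\lambda\to\infty}\mathcal P_y(\lambda)$. -/

import Mathlib

open MeasureTheory ProbabilityTheory Filter Topology
open scoped NNReal ENNReal

noncomputable section

/-! ### Regular variation at infinity -/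

/-- `h` is positive and Lebesgue measurable on `(0, ∞)` and `h (t x) / h x → t ^ ρ` as `x → ∞`,
for every `t > 0`. Index `0` is slow variation. -/
def RegularlyVarying (h : ℝ → ℝ) (ρ : ℝ) : Prop :=
  (∀ x, 0 < x → 0 < h x) ∧
  AEMeasurable h (volume.restrict (Set.Ioi 0)) ∧
  ∀ t : ℝ, 0 < t → Tendsto (fun x => h (t * x) / h x) atTop (𝓝 (t ^ ρ))

/-- Regular variation with index `-∞` (rapid variation): `h (t x) / h x` tends to `0` for `t > 1`
and to `∞` for `0 < t < 1`. -/
def RapidlyVarying (h : ℝ → ℝ) : Prop :=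
  (∀ x, 0 < x → 0 < h x) ∧
  AEMeasurable h (volume.restrict (Set.Ioi 0)) ∧
  (∀ t : ℝ, 1 < t → Tendsto (fun x => h (t * x) / h x) atTop (𝓝 0)) ∧
  (∀ t : ℝ, 0 < t → t < 1 → Tendsto (fun x => h (t * x) / h x) atTop atTop)

/-- The tail `t ↦ μ (t, ∞)` of a law on the real line. -/
def tail (μ : Measure ℝ) (t : ℝ) : ℝ := μ.real (Set.Ioi t)

/-- The tail of `μ` is of smaller order than a rapidly varying tail of some distribution. -/
def LighterThanRapid (μ : Measure ℝ) : Prop :=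
  ∃ H : Measure ℝ, IsProbabilityMeasure H ∧ RapidlyVarying (tail H) ∧
    tail μ =o[atTop] tail H

/-- The classified tails: regularly varying of index `-ρ` with `0 ≤ ρ < ∞`, rapidly varying, or of
smaller order than a rapidly varying tail. -/
def ClassifiedTail (μ : Measure ℝ) : Prop :=
  (∃ ρ : ℝ, 0 ≤ ρ ∧ RegularlyVarying (tail μ) (-ρ)) ∨ RapidlyVarying (tail μ) ∨
    LighterThanRapid μ

/-! ### The network -/

/-- Parameters of a continuous multi-slope pathloss function with `K` slopes in dimension `d`.
Only `R 0, …, R K` and `A k`, `β k` with `k < K` matter. -/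
structure Pathloss (d : ℕ) where
  K : ℕ
  one_le_K : 1 ≤ K
  A : ℕ → ℝ
  β : ℕ → ℝ
  R : ℕ → ℝ
  R_zero : R 0 = 0
  R_lt : ∀ k, k < K → R k < R (k + 1)
  β_zero_nonneg : 0 ≤ β 0
  β_ge : ∀ k, 1 ≤ k → k < K → (d : ℝ) - 1 ≤ β k
  β_lt : ∀ k, k + 1 < K → β k < β (k + 1)
  A_pos : ∀ k, k < K → 0 < A k
  A_cont : ∀ k, k + 1 < K → A k * R (k + 1) ^ β k = A (k + 1) * R (k + 1) ^ β (k + 1)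

namespace Pathloss

variable {d : ℕ} (L : Pathloss d)

/-- The radius `R_∞` of the network domain. -/
def Rinf : ℝ := L.R L.K

/-- The pathloss `l r = ∑_{k < K} A_k r ^ β_k 1(R_k ≤ r < R_{k+1})`. -/
def loss (r : ℝ) : ℝ :=
  ∑ k ∈ Finset.range L.K,
    (Set.Ico (L.R k) (L.R (k + 1))).indicator (fun s => L.A k * s ^ L.β k) r

/-- The network domain: the ball of radius `R_∞` around the user, who sits at the origin. -/
def domain : Set (EuclideanSpace ℝ (Fin d)) := Metric.ball 0 L.Rinf

/-- The law of a node (position, channel power): the position is uniform on the network domain,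
the channel power is independent of it and has law `F`. -/
def nodeLaw (F : Measure ℝ) : Measure (EuclideanSpace ℝ (Fin d) × ℝ) :=
  (cond volume L.domain).prod F

/-- The power received at the origin from a node: channel power over pathloss. -/
def power (z : EuclideanSpace ℝ (Fin d) × ℝ) : ℝ := z.2 / L.loss ‖z.1‖

/-- The law of the received power `P` from a random node. -/
def powerLaw (F : Measure ℝ) : Measure ℝ := (L.nodeLaw F).map L.power

/-- A finite configuration of marked points: the points of `ω` are the first `ω.1` terms of the
sequence `ω.2`. -/
abbrev Config (d : ℕ) : Type := ℕ × (ℕ → EuclideanSpace ℝ (Fin d) × ℝ)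

/-- The independently marked homogeneous Poisson point process of intensity `lam` on the network
domain: the number of nodes is Poisson with mean `lam` times the volume of the domain, and,
independently of this number, the nodes are i.i.d. with uniform positions and independent
marks of law `F`. -/
def network (F : Measure ℝ) [IsProbabilityMeasure F] (lam : ℝ≥0) : Measure (Config d) :=
  (poissonMeasure (lam * (volume L.domain).toNNReal)).prod
    (Measure.infinitePi fun _ : ℕ => L.nodeLaw F)

/-- The signal quality `Q_i = P_i / (I_i + W)` of the `i`-th node, where `I_i` is the sum of the
powers received from all other nodes. -/
def quality (W : ℝ) (ω : Config d) (i : ℕ) : ℝ :=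
  L.power (ω.2 i) / ((∑ j ∈ (Finset.range ω.1).erase i, L.power (ω.2 j)) + W)

/-- The signal-to-interference-plus-noise ratio from the strongest cell, `max_i Q_i`. It is `0` when
there is no node (the supremum over an empty index type). -/
def sinr (W : ℝ) (ω : Config d) : ℝ := ⨆ i : Fin ω.1, L.quality W ω i

/-- The coverage probability `ℙ (SINR ≥ y)` at density `lam`. -/
def coverage (F : Measure ℝ) [IsProbabilityMeasure F] (W y : ℝ) (lam : ℝ≥0) : ℝ :=
  (L.network F lam).real {ω | y ≤ L.sinr W ω}

/-- The average rate `𝔼 log (1 + SINR) ∈ [0, ∞]` at density `lam`. -/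
def rate (F : Measure ℝ) [IsProbabilityMeasure F] (W : ℝ) (lam : ℝ≥0) : ℝ≥0∞ :=
  ∫⁻ ω, ENNReal.ofReal (Real.log (1 + L.sinr W ω)) ∂(L.network F lam)

end Pathloss

end

/-! Geometry enters only through the mean node count `Λ` and the law of one received power: given
the number of nodes, the powers are i.i.d., and the SINR is a symmetric function of them. Let `G` be
the tail quantile function of that law. A power is distributed as `G U` with `U` uniform on `(0,
1]`, and a Poisson number of mean `Λ` of uniform points is, up to order, the set of arrival times
`A_k / Λ` that fall into `(0, 1]`, where `A_k` are partial sums of independent unit exponentials.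
Since `G` decreases, the first arrival is the strongest node, so for every positive density the SINR
has the law of `G (A_1 / Λ) / (∑_{k ≥ 2} G (A_k / Λ) + W)` on one fixed probability space
(`Pathloss.lintegral_network_eq_waiting`). Letting the density grow is then a pathwise limit at the
origin for `G`.

Regular variation of index `-α` inverts to `G (a v) / G v → a ^ (-1/α)` as `v → 0`, or to `0` if `α
= 0` and `a > 1`. For `α < 1` there is also a bound `G (a v) ≤ C a ^ (-γ) G v` with `γ > 1`. Since
`A_k` grows at least linearly, dominated convergence shows that 1/SINR tends almost surely to `Y =
∑_{k ≥ 2} (A_k / A_1) ^ (-1/α)`, the noise being negligible (`tendsto_arrivalInterference_ratio`).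
For `α = 0` this limit is `0`: the strongest node beats all others together, and coverage tends to
one. For `0 < α < 1` the variable `Y` is positive, has no atoms and is small with positive
probability. Hence coverage tends to `ℙ (Y ≤ 1/y) > 0`, and the rate to `𝔼 log (1 + 1/Y)`, which is
positive and finite by a domination uniform in the density. Saturation follows because these limits
are neither zero nor infinite.

In the remaining cases the mean power is finite (`lintegral_ofReal_lt_top_of_classified`).
Interference then grows linearly in the number of nodes while one power rarely does, so the mean
SINR of `n` nodes vanishes (`tendsto_lintegral_sinrOf`). Poisson mixing carries this to the rate,
and Markov's inequality to coverage. Positivity at density one comes from the event that there is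
exactly one node. -/

/-! ### Splitting off the first coordinate of an i.i.d. sequence -/

/-- Prepend a term to a sequence. -/
def seqCons {α : Type*} (p : α × (ℕ → α)) : ℕ → α := fun n => Nat.casesOn n p.1 p.2

@[simp] theorem seqCons_zero {α : Type*} (p : α × (ℕ → α)) : seqCons p 0 = p.1 := rfl

@[simp] theorem seqCons_succ {α : Type*} (p : α × (ℕ → α)) (n : ℕ) :
    seqCons p (n + 1) = p.2 n := rfl

theorem measurable_seqCons {α : Type*} [MeasurableSpace α] :
    Measurable (seqCons : α × (ℕ → α) → ℕ → α) := by
  refine measurable_pi_lambda _ fun n => ?_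
  cases n with
  | zero => exact measurable_fst
  | succ n => exact (measurable_pi_apply n).comp measurable_snd

theorem map_seqCons_prod_infinitePi {α : Type*} [MeasurableSpace α] (ρ : Measure α)
    [IsProbabilityMeasure ρ] :
    (ρ.prod (Measure.infinitePi fun _ : ℕ => ρ)).map seqCons =
      Measure.infinitePi fun _ : ℕ => ρ := by
  classical
  refine Measure.eq_infinitePi _ fun s t ht => ?_
  obtain ⟨N, hN⟩ : ∃ N : ℕ, s ⊆ Finset.range (N + 1) :=
    ⟨s.sup id, fun i hi => Finset.mem_range_succ_iff.2 (Finset.le_sup (f := id) hi)⟩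
  -- Padding with the whole space turns the index set into an initial segment, from which the index
  -- `0` splits off.
  set t' : ℕ → Set α := fun i => if i ∈ s then t i else Set.univ with ht'
  have hm : ∀ i, MeasurableSet (t' i) := fun i => by
    simp only [ht']; split_ifs
    exacts [ht i, .univ]
  have h1 : ∏ i ∈ s, ρ (t i) = ∏ i ∈ Finset.range (N + 1), ρ (t' i) := by
    rw [← Finset.prod_subset hN (f := fun i => ρ (t' i))]
    · exact Finset.prod_congr rfl fun i hi => by simp [ht', hi]
    · intro i _ hi
      simp [ht', hi]
  have h2 : seqCons ⁻¹' (Set.pi s t) =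
      t' 0 ×ˢ Set.pi (Finset.range N : Set ℕ) (fun i => t' (i + 1)) := by
    ext p
    simp only [Set.mem_preimage, Set.mem_pi, Set.mem_prod, ht', Finset.mem_coe, Finset.mem_range]
    constructor
    · intro h
      refine ⟨?_, fun i _ => ?_⟩
      · split_ifs with h0
        · exact h 0 h0
        · trivial
      · split_ifs with h0
        · exact h (i + 1) h0
        · trivial
    · rintro ⟨h0, h⟩ i hi
      cases i with
      | zero => simpa [hi] using h0
      | succ i =>
        have := h i (by have := Finset.mem_range.1 (hN hi); omega)
        simpa [hi] using this
  rw [Measure.map_apply measurable_seqCons (.pi s.countable_toSet fun i _ => ht i), h2,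
    Measure.prod_prod, Measure.infinitePi_pi _ fun i _ => hm (i + 1), h1,
    Finset.prod_range_succ', mul_comm]

theorem lintegral_infinitePi_seqCons {α : Type*} [MeasurableSpace α] (ρ : Measure α)
    [IsProbabilityMeasure ρ] {f : (ℕ → α) → ℝ≥0∞} (hf : Measurable f) :
    ∫⁻ e, f e ∂(Measure.infinitePi fun _ : ℕ => ρ) =
      ∫⁻ x, ∫⁻ e, f (seqCons (x, e)) ∂(Measure.infinitePi fun _ : ℕ => ρ) ∂ρ := by
  conv_lhs => rw [← map_seqCons_prod_infinitePi ρ]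
  rw [lintegral_map hf measurable_seqCons,
    lintegral_prod _ (Measurable.aemeasurable (f := fun p => f (seqCons p))
      (hf.comp measurable_seqCons))]

theorem map_infinitePi_fin {α : Type*} [MeasurableSpace α] (ρ : Measure α)
    [IsProbabilityMeasure ρ] (n : ℕ) :
    (Measure.infinitePi fun _ : ℕ => ρ).map (fun p (i : Fin n) => p i) =
      Measure.pi fun _ : Fin n => ρ := by
  rw [← Measure.infinitePi_eq_pi]
  exact Measure.map_infinitePi_infinitePi_of_inj (P := fun _ : ℕ => ρ) Fin.val_injective

/-! ### The unit exponential law -/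

/-- The exponential law of rate one. -/
noncomputable def expLaw : Measure ℝ :=
  (volume.restrict (Set.Ioi 0)).withDensity fun x => ENNReal.ofReal (Real.exp (-x))

theorem measurable_ofReal_exp_neg : Measurable fun x : ℝ => ENNReal.ofReal (Real.exp (-x)) := by
  fun_prop

theorem expLaw_Ioi {c : ℝ} (hc : 0 ≤ c) :
    expLaw (Set.Ioi c) = ENNReal.ofReal (Real.exp (-c)) := by
  rw [expLaw, withDensity_apply _ measurableSet_Ioi, Measure.restrict_restrict measurableSet_Ioi,
    Set.Ioi_inter_Ioi, max_eq_left hc, ← ofReal_integral_eq_lintegral_ofReal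
      (integrableOn_exp_neg_Ioi c) (ae_of_all _ fun x => (Real.exp_pos _).le),
    integral_exp_neg_Ioi]

theorem lintegral_expLaw {f : ℝ → ℝ≥0∞} (hf : Measurable f) :
    ∫⁻ x, f x ∂expLaw = ∫⁻ x in Set.Ioi 0, ENNReal.ofReal (Real.exp (-x)) * f x := by
  rw [expLaw, lintegral_withDensity_eq_lintegral_mul _ measurable_ofReal_exp_neg hf]
  rfl

theorem expLaw_absolutelyContinuous : expLaw ≪ volume.restrict (Set.Ioi 0) :=
  withDensity_absolutelyContinuous _ _

instance : NullSingletonClass expLaw := ⟨fun x => expLaw_absolutelyContinuous (by simp)⟩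

theorem ae_pos_expLaw : ∀ᵐ x ∂expLaw, 0 < x :=
  expLaw_absolutelyContinuous.ae_le (ae_restrict_mem measurableSet_Ioi)

instance : IsProbabilityMeasure expLaw := by
  constructor
  have h : expLaw (Set.Iic 0) = 0 := by
    have := ae_pos_expLaw
    rw [ae_iff] at this
    simpa [Set.Iic] using this
  have := measure_union_add_inter (μ := expLaw) (Set.Iic (0:ℝ)) (measurableSet_Ioi (a := (0:ℝ)))
  rw [Set.Iic_union_Ioi, h, expLaw_Ioi le_rfl] at this
  simpa [measure_mono_null (Set.inter_subset_left) h] using this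

theorem expLaw_Ioo_pos {δ : ℝ} (hδ : 0 < δ) : expLaw (Set.Ioo 0 δ) ≠ 0 := by
  intro h
  have h1 : expLaw (Set.Ioi 0) = expLaw (Set.Ici δ) := by
    rw [← Set.Ioo_union_Ici_eq_Ioi hδ]
    refine le_antisymm ((measure_union_le _ _).trans (by rw [h, zero_add])) (measure_mono
      Set.subset_union_right)
  rw [← Ioi_ae_eq_Ici.measure_eq, expLaw_Ioi hδ.le, expLaw_Ioi le_rfl,
    ENNReal.ofReal_eq_ofReal_iff (Real.exp_pos _).le (Real.exp_pos _).le] at h1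
  have := Real.exp_injective h1
  linarith

/-- The first arrival after `t` in a Poisson process of rate `Λ` has density `Λ exp (-Λ (x - t))` on
`(t, ∞)`; this is that change of variables. -/
theorem lintegral_expLaw_affine {Λ t : ℝ} (hΛ : 0 < Λ) {f : ℝ → ℝ≥0∞} (hf : Measurable f) :
    ∫⁻ x, f (t + x / Λ) ∂expLaw =
      ∫⁻ x in Set.Ioi t, ENNReal.ofReal (Λ * Real.exp (-(Λ * (x - t)))) * f x := by
  rw [lintegral_expLaw (by fun_prop)]
  have hmap : (volume : Measure ℝ).map (fun x => Λ * (x - t)) = ENNReal.ofReal Λ⁻¹ • volume := by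
    have h := Real.map_volume_mul_left hΛ.ne'
    have h2 : (fun x : ℝ => Λ * (x - t)) = (fun x => Λ * x) ∘ (fun x => x + (-t)) := by
      ext x; simp [sub_eq_add_neg]
    rw [h2, ← Measure.map_map (by fun_prop) (by fun_prop), map_add_right_eq_self, h,
      abs_of_pos (inv_pos.2 hΛ)]
  have hv : (volume : Measure ℝ) =
      ENNReal.ofReal Λ • (volume : Measure ℝ).map (fun x => Λ * (x - t)) := by
    rw [hmap, smul_smul, ← ENNReal.ofReal_mul hΛ.le, mul_inv_cancel₀ hΛ.ne']
    simp
  have hm : Measurable fun a => (Set.Ioi (0:ℝ)).indicator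
      (fun x => ENNReal.ofReal (Real.exp (-x)) * f (t + x / Λ)) (Λ * (a - t)) :=
    Measurable.comp (g := (Set.Ioi (0:ℝ)).indicator
      (fun x => ENNReal.ofReal (Real.exp (-x)) * f (t + x / Λ)))
      (Measurable.indicator (by fun_prop) measurableSet_Ioi) (by fun_prop)
  rw [← lintegral_indicator measurableSet_Ioi, ← lintegral_indicator measurableSet_Ioi]
  conv_lhs => rw [hv]
  rw [lintegral_smul_measure, lintegral_map (Measurable.indicator (by fun_prop) measurableSet_Ioi)
    (by fun_prop), smul_eq_mul, ← lintegral_const_mul _ hm]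
  refine lintegral_congr fun x => ?_
  have hx : Λ * (x - t) ∈ Set.Ioi (0:ℝ) ↔ x ∈ Set.Ioi t := by
    simp [hΛ, mul_pos_iff_of_pos_left]
  have hx2 : t + Λ * (x - t) / Λ = x := by field_simp; ring
  by_cases h : x ∈ Set.Ioi t
  · rw [Set.indicator_of_mem h, Set.indicator_of_mem (hx.2 h), hx2, ← mul_assoc,
      ← ENNReal.ofReal_mul hΛ.le]
  · rw [Set.indicator_of_notMem h, Set.indicator_of_notMem (fun h' => h (hx.1 h')), mul_zero]

/-! ### Decomposing a symmetric integral at the smallest coordinate -/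

theorem volume_eq_coords_zero {n : ℕ} {i j : Fin n} (hij : i ≠ j) :
    (volume : Measure (Fin n → ℝ)) {x | x i = x j} = 0 := by
  classical
  let s : Submodule ℝ (Fin n → ℝ) := LinearMap.ker (LinearMap.proj (R := ℝ) (φ := fun _ => ℝ) i -
    LinearMap.proj (R := ℝ) (φ := fun _ => ℝ) j)
  have hs : s ≠ ⊤ := by
    intro h
    have : Pi.single i (1:ℝ) ∈ s := by rw [h]; trivial
    simp [s, hij.symm] at this
  have := Measure.addHaar_submodule volume s hs
  convert this using 2
  ext x
  simp [s, sub_eq_zero]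

/-- Ties lie in hyperplanes and are null, so exactly one coordinate is smallest, and by symmetry
each contributes equally. Once the minimum is `a`, the others range freely over `(a, T]`. This
mirrors restarting a Poisson process at its first arrival. -/
theorem lintegral_pi_symmetric {n : ℕ} {t T : ℝ} {g : (Fin (n + 1) → ℝ) → ℝ≥0∞}
    (hg : Measurable g) (hs : ∀ (σ : Equiv.Perm (Fin (n + 1))) x, g (x ∘ σ) = g x) :
    ∫⁻ x, g x ∂(Measure.pi fun _ => volume.restrict (Set.Ioc t T)) =
      (n + 1 : ℕ) * ∫⁻ a in Set.Ioc t T, ∫⁻ y, g (Fin.cons a y)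
        ∂(Measure.pi fun _ : Fin n => volume.restrict (Set.Ioc a T)) := by
  classical
  set ν : Measure ℝ := volume.restrict (Set.Ioc t T) with hν
  set A : Fin (n + 1) → Set (Fin (n + 1) → ℝ) := fun i => {x | ∀ j, j ≠ i → x i < x j} with hA
  have hAm : ∀ i, MeasurableSet (A i) := by
    intro i
    have : A i = ⋂ j, {x | j ≠ i → x i < x j} := by ext; simp [hA]
    rw [this]
    refine MeasurableSet.iInter fun j => ?_
    by_cases h : j = i
    · simp [h]
    · simpa [h] using measurableSet_lt (measurable_pi_apply i) (measurable_pi_apply j)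
  have hdis : Pairwise (Function.onFun Disjoint A) := by
    intro i j hij
    refine Set.disjoint_left.2 fun x hx hx' => ?_
    exact lt_asymm (hx j hij.symm) (hx' i hij)
  have hpi : (Measure.pi fun _ : Fin (n + 1) => ν) =
      (volume : Measure (Fin (n + 1) → ℝ)).restrict (Set.univ.pi fun _ => Set.Ioc t T) := by
    rw [volume_pi, Measure.restrict_pi_pi]
  have hcov : ∀ᵐ x ∂(Measure.pi fun _ : Fin (n + 1) => ν), x ∈ ⋃ i, A i := by
    rw [hpi]
    refine ae_restrict_of_ae ?_
    have h1 : ∀ᵐ x ∂(volume : Measure (Fin (n + 1) → ℝ)), ∀ i j, i ≠ j → x i ≠ x j := by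
      rw [ae_all_iff]; intro i; rw [ae_all_iff]; intro j
      by_cases h : i = j
      · simp [h]
      · have := volume_eq_coords_zero h
        rw [ae_iff]
        simpa [h] using this
    filter_upwards [h1] with x hx
    obtain ⟨i, -, hi⟩ := Finset.exists_min_image Finset.univ x Finset.univ_nonempty
    exact Set.mem_iUnion.2 ⟨i, fun j hj => lt_of_le_of_ne (hi j (Finset.mem_univ _))
      (hx i j hj.symm)⟩
  have hsum : ∫⁻ x, g x ∂(Measure.pi fun _ => ν) =
      ∑ i, ∫⁻ x in A i, g x ∂(Measure.pi fun _ => ν) := by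
    rw [← tsum_fintype (L := .unconditional _), ← lintegral_iUnion hAm hdis, Measure.restrict_eq_self_of_ae_mem hcov]
  have hswap : ∀ i, ∫⁻ x in A i, g x ∂(Measure.pi fun _ => ν) =
      ∫⁻ x in A 0, g x ∂(Measure.pi fun _ => ν) := by
    intro i
    -- The transposition of `0` and `i` preserves the measure and `g`, and carries the region where
    -- `i` is minimal to the one where `0` is.
    set σ : Equiv.Perm (Fin (n + 1)) := Equiv.swap 0 i with hσ
    have hmp := measurePreserving_piCongrLeft (fun _ : Fin (n + 1) => ν) σ
    have hc : ∀ x : Fin (n + 1) → ℝ,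
        MeasurableEquiv.piCongrLeft (fun _ => ℝ) σ x = x ∘ σ := by
      intro x
      ext j
      rw [MeasurableEquiv.coe_piCongrLeft]
      have := Equiv.piCongrLeft_apply_apply (fun _ => ℝ) σ x (σ j)
      have hj : σ (σ j) = j := Equiv.swap_apply_self _ _ j
      rw [hj] at this
      simpa using this
    rw [← hmp.setLIntegral_comp_preimage_emb (MeasurableEquiv.measurableEmbedding _)]
    have hpre : (MeasurableEquiv.piCongrLeft (fun _ => ℝ) σ) ⁻¹' (A i) = A 0 := by
      ext x
      simp only [Set.mem_preimage, hc, hA, Set.mem_ofPred_eq, Function.comp]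
      have hi : σ i = 0 := Equiv.swap_apply_right _ _
      constructor
      · intro h j hj
        have h2 := h (σ j) (fun h3 => hj (by rw [← hi, ← h3]; simp [hσ]))
        rw [hi] at h2
        simpa [hσ] using h2
      · intro h j hj
        rw [hi]
        exact h _ (fun h3 => hj (σ.injective (h3.trans hi.symm)))
    rw [hpre]
    exact lintegral_congr fun x => by rw [hc, hs]
  rw [hsum, Finset.sum_congr rfl fun i _ => hswap i, Finset.sum_const, Finset.card_univ,
    Fintype.card_fin, nsmul_eq_mul]
  congr 1
  have hmp := (measurePreserving_piFinSuccAbove (fun _ : Fin (n + 1) => ν) 0).symm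
  rw [← lintegral_indicator (hAm 0), ← hmp.lintegral_comp_emb
    (MeasurableEquiv.measurableEmbedding _), lintegral_prod _
      (Measurable.aemeasurable (f := fun p => (A 0).indicator g
        ((MeasurableEquiv.piFinSuccAbove (fun _ => ℝ) (0 : Fin (n + 1))).symm p))
        ((hg.indicator (hAm 0)).comp (MeasurableEquiv.measurable _)))]
  refine setLIntegral_congr_fun measurableSet_Ioc fun a ha => ?_
  have hm : (Measure.pi fun _ : Fin n => volume.restrict (Set.Ioc a T)) =
      (Measure.pi fun _ : Fin n => ν).restrict (Set.univ.pi fun _ => Set.Ioi a) := by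
    rw [Measure.restrict_pi_pi]
    congr with j
    rw [hν, Measure.restrict_restrict measurableSet_Ioi]
    congr 2
    ext z
    simp only [Set.mem_Ioc, Set.mem_inter_iff, Set.mem_Ioi]
    exact ⟨fun h => ⟨h.1, ha.1.trans h.1, h.2⟩, fun h => ⟨h.1, h.2.2⟩⟩
  have hms : MeasurableSet (Set.univ.pi fun _ : Fin n => Set.Ioi a) :=
    .univ_pi fun _ => measurableSet_Ioi
  simp only [hm]
  rw [← lintegral_indicator hms]
  refine lintegral_congr fun y => ?_
  have he : (MeasurableEquiv.piFinSuccAbove (fun _ => ℝ) (0 : Fin (n + 1))).symm (a, y) =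
      Fin.cons a y := by
    rw [MeasurableEquiv.piFinSuccAbove_symm_apply]
    simp [Fin.insertNthEquiv]
  rw [he]
  have hiff : (Fin.cons a y : Fin (n + 1) → ℝ) ∈ A 0 ↔ y ∈ Set.univ.pi fun _ : Fin n => Set.Ioi a := by
    simp only [hA, Set.mem_ofPred_eq, Set.mem_pi, Set.mem_univ, true_imp_iff, Set.mem_Ioi]
    constructor
    · intro h j
      simpa using h j.succ (Fin.succ_ne_zero j)
    · intro h j hj
      obtain ⟨k, rfl⟩ := Fin.exists_succ_eq.2 hj
      simpa using h k
  by_cases h : y ∈ Set.univ.pi fun _ : Fin n => Set.Ioi a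
  · rw [Set.indicator_of_mem h, Set.indicator_of_mem (hiff.2 h)]
  · rw [Set.indicator_of_notMem h, Set.indicator_of_notMem (fun h' => h (hiff.1 h'))]

/-! ### Arrival times -/

/-- The `k`-th partial sum of a sequence of waiting times. -/
noncomputable def arrival (k : ℕ) (e : ℕ → ℝ) : ℝ := ∑ j ∈ Finset.range k, e j

@[simp] theorem arrival_zero (e : ℕ → ℝ) : arrival 0 e = 0 := by simp [arrival]

theorem arrival_succ (k : ℕ) (e : ℕ → ℝ) : arrival (k + 1) e = arrival k e + e k :=
  Finset.sum_range_succ _ _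

@[simp] theorem arrival_succ_seqCons (k : ℕ) (p : ℝ × (ℕ → ℝ)) :
    arrival (k + 1) (seqCons p) = p.1 + arrival k p.2 := by
  rw [arrival, Finset.sum_range_succ', add_comm]
  rfl

@[fun_prop] theorem measurable_arrival (k : ℕ) : Measurable (arrival k) := by
  unfold arrival; fun_prop

/-- The law of a sequence of independent unit exponential waiting times. -/
noncomputable def waiting : Measure (ℕ → ℝ) := Measure.infinitePi fun _ : ℕ => expLaw

instance : IsProbabilityMeasure waiting := by unfold waiting; infer_instance

theorem lintegral_waiting_seqCons {f : (ℕ → ℝ) → ℝ≥0∞} (hf : Measurable f) :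
    ∫⁻ e, f e ∂waiting = ∫⁻ x, ∫⁻ e, f (seqCons (x, e)) ∂waiting ∂expLaw :=
  lintegral_infinitePi_seqCons expLaw hf

/-- The event that exactly `n` of the arrival times, sped up by `Λ` and started at `t`, fall into
`(t, 1]`. -/
def countEvent (Λ t : ℝ) (n : ℕ) : Set (ℕ → ℝ) :=
  {e | t + arrival n e / Λ ≤ 1 ∧ 1 < t + arrival (n + 1) e / Λ}

theorem measurableSet_mem_countEvent {α : Type*} [MeasurableSpace α] (Λ : ℝ) (n : ℕ)
    {a : α → ℝ} {f : α → ℕ → ℝ} (ha : Measurable a) (hf : Measurable f) :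
    MeasurableSet {p | f p ∈ countEvent Λ (a p) n} := by
  have h : {p | f p ∈ countEvent Λ (a p) n} = {p | a p + arrival n (f p) / Λ ≤ 1} ∩
      {p | 1 < a p + arrival (n + 1) (f p) / Λ} := rfl
  rw [h]
  exact (measurableSet_le (by fun_prop) (by fun_prop)).inter
    (measurableSet_lt (by fun_prop) (by fun_prop))

theorem measurableSet_countEvent (Λ t : ℝ) (n : ℕ) : MeasurableSet (countEvent Λ t n) :=
  measurableSet_mem_countEvent Λ n (measurable_const (a := t)) measurable_id

/-- Induction on `n` with the starting time `t` free. The left side is split at its smallest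
coordinate `a`, the right side at the first arrival; both leave the same statement for `n` points
started at `a`. -/
theorem lintegral_symmetric_eq_arrival {Λ : ℝ} (hΛ : 0 < Λ) (n : ℕ) :
    ∀ {t : ℝ}, t ≤ 1 → ∀ {g : (Fin n → ℝ) → ℝ≥0∞}, Measurable g →
      (∀ (σ : Equiv.Perm (Fin n)) x, g (x ∘ σ) = g x) →
      ENNReal.ofReal (Real.exp (-(Λ * (1 - t))) * Λ ^ n) *
          ∫⁻ x, g x ∂(Measure.pi fun _ => volume.restrict (Set.Ioc t 1)) =
        (n.factorial : ℝ≥0∞) * ∫⁻ e, (countEvent Λ t n).indicator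
          (fun e => g fun i => t + arrival (i + 1) e / Λ) e ∂waiting := by
  induction n with
  | zero =>
    intro t ht g hg _
    have h1 : ∀ e : ℕ → ℝ, (fun i : Fin 0 => t + arrival (i + 1) e / Λ) = default :=
      fun e => Subsingleton.elim _ _
    simp only [h1]
    rw [lintegral_indicator_const (measurableSet_countEvent _ _ _)]
    have h2 : waiting (countEvent Λ t 0) = ENNReal.ofReal (Real.exp (-(Λ * (1 - t)))) := by
      have h3 : countEvent Λ t 0 = (fun e : ℕ → ℝ => e 0) ⁻¹' Set.Ioi (Λ * (1 - t)) := by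
        ext e
        have : arrival 1 e = e 0 := by simp [arrival]
        simp only [countEvent, arrival_zero, zero_div, add_zero, zero_add, this, Set.mem_ofPred_eq,
          Set.mem_preimage, Set.mem_Ioi, ht, true_and]
        rw [← sub_lt_iff_lt_add', lt_div_iff₀ hΛ, mul_comm]
      rw [h3, ← Measure.map_apply (measurable_pi_apply 0) measurableSet_Ioi, waiting,
        Measure.infinitePi_map_eval, expLaw_Ioi (by nlinarith)]
    rw [h2, Measure.pi_of_empty _ default, lintegral_dirac]
    simp [mul_comm]
  | succ n ih =>
    intro t ht g hg hs
    rw [lintegral_pi_symmetric hg hs]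
    have hmeas : Measurable fun e : ℕ → ℝ => (countEvent Λ t (n + 1)).indicator
        (fun e => g fun i => t + arrival (i + 1) e / Λ) e :=
      Measurable.indicator (hg.comp (measurable_pi_lambda _ fun i => by fun_prop))
        (measurableSet_countEvent _ _ _)
    have hmeas2 : Measurable fun p : ℝ × (ℕ → ℝ) => (countEvent Λ p.1 n).indicator
        (fun e => g (Fin.cons p.1 fun i => p.1 + arrival (i + 1) e / Λ)) p.2 := by
      have hset : MeasurableSet {p : ℝ × (ℕ → ℝ) | p.2 ∈ countEvent Λ p.1 n} :=
        measurableSet_mem_countEvent Λ n measurable_fst measurable_snd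
      have : (fun p : ℝ × (ℕ → ℝ) => (countEvent Λ p.1 n).indicator
          (fun e => g (Fin.cons p.1 fun i => p.1 + arrival (i + 1) e / Λ)) p.2) =
          {p : ℝ × (ℕ → ℝ) | p.2 ∈ countEvent Λ p.1 n}.indicator
            (fun p => g (Fin.cons p.1 fun i => p.1 + arrival (i + 1) p.2 / Λ)) := by
        ext p
        by_cases h : p.2 ∈ countEvent Λ p.1 n
        · simp [h]
        · simp [h]
      rw [this]
      refine Measurable.indicator (hg.comp (measurable_pi_lambda _ fun i => ?_)) hset
      refine Fin.cases ?_ (fun i => ?_) i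
      · simpa using measurable_fst
      · simp only [Fin.cons_succ]; fun_prop
    set J : ℝ → ℝ≥0∞ := fun a => ∫⁻ e, (countEvent Λ a n).indicator
        (fun e => g (Fin.cons a fun i => a + arrival (i + 1) e / Λ)) e ∂waiting with hJ
    have hJm : Measurable J := hmeas2.lintegral_prod_right'
    -- A process started after time `1` never satisfies the count event, so the first arrival may be
    -- restricted to `(t, 1]`.
    have hJ0 : ∀ a, 1 < a → J a = 0 := by
      intro a ha
      have hev : ∀ᵐ e ∂waiting, e ∉ countEvent Λ a n := by
        have hpos : ∀ᵐ e ∂waiting, ∀ i, 0 < e i := by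
          rw [ae_all_iff]
          intro i
          have := (measurePreserving_eval_infinitePi (fun _ : ℕ => expLaw) i)
          exact this.quasiMeasurePreserving.ae ae_pos_expLaw
        filter_upwards [hpos] with e he h
        have h1 : 0 ≤ arrival n e := Finset.sum_nonneg fun j _ => (he j).le
        have h2 := h.1
        have : 0 ≤ arrival n e / Λ := by positivity
        linarith
      rw [hJ]
      simp only
      rw [← lintegral_zero (μ := waiting)]
      refine lintegral_congr_ae ?_
      filter_upwards [hev] with e he
      rw [Set.indicator_of_notMem he]
    have hR : ∫⁻ e, (countEvent Λ t (n + 1)).indicator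
        (fun e => g fun i => t + arrival (i + 1) e / Λ) e ∂waiting =
        ∫⁻ x, J (t + x / Λ) ∂expLaw := by
      rw [lintegral_waiting_seqCons hmeas]
      refine lintegral_congr fun x => lintegral_congr fun e => ?_
      have hiff : seqCons (x, e) ∈ countEvent Λ t (n + 1) ↔ e ∈ countEvent Λ (t + x / Λ) n := by
        simp only [countEvent, Set.mem_ofPred_eq, arrival_succ_seqCons, add_div, ← add_assoc]
      have hfun : (fun i : Fin (n + 1) => t + arrival (i + 1) (seqCons (x, e)) / Λ) =
          Fin.cons (t + x / Λ) fun i : Fin n => t + x / Λ + arrival (i + 1) e / Λ := by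
        ext i
        refine Fin.cases ?_ (fun i => ?_) i
        · simp
        · simp [add_div, add_assoc]
      by_cases h : e ∈ countEvent Λ (t + x / Λ) n
      · rw [Set.indicator_of_mem h, Set.indicator_of_mem (hiff.2 h), hfun]
      · rw [Set.indicator_of_notMem h, Set.indicator_of_notMem (fun h' => h (hiff.1 h'))]
    rw [hR, lintegral_expLaw_affine hΛ hJm, Nat.factorial_succ]
    have hI : ∫⁻ x in Set.Ioi t, ENNReal.ofReal (Λ * Real.exp (-(Λ * (x - t)))) * J x =
        ∫⁻ x in Set.Ioc t 1, ENNReal.ofReal (Λ * Real.exp (-(Λ * (x - t)))) * J x := by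
      rw [← lintegral_indicator measurableSet_Ioi, ← lintegral_indicator measurableSet_Ioc]
      refine lintegral_congr fun x => ?_
      by_cases h1 : x ≤ 1
      · by_cases h2 : t < x
        · rw [Set.indicator_of_mem (Set.mem_Ioi.2 h2), Set.indicator_of_mem (Set.mem_Ioc.2 ⟨h2, h1⟩)]
        · rw [Set.indicator_of_notMem (s := Set.Ioi t) h2,
            Set.indicator_of_notMem (fun h => h2 h.1)]
      · rw [Set.indicator_of_notMem (s := Set.Ioc t 1) (fun h => h1 h.2)]
        by_cases h2 : t < x
        · rw [Set.indicator_of_mem (Set.mem_Ioi.2 h2), hJ0 x (not_le.1 h1), mul_zero]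
        · rw [Set.indicator_of_notMem (s := Set.Ioi t) h2]
    rw [hI]
    have hkey : ∀ a ∈ Set.Ioc t 1, ENNReal.ofReal (Real.exp (-(Λ * (1 - t))) * Λ ^ (n + 1)) *
        ∫⁻ y, g (Fin.cons a y) ∂(Measure.pi fun _ : Fin n => volume.restrict (Set.Ioc a 1)) =
        (n.factorial : ℝ≥0∞) * (ENNReal.ofReal (Λ * Real.exp (-(Λ * (a - t)))) * J a) := by
      intro a ha
      have hsa : ∀ (σ : Equiv.Perm (Fin n)) x,
          (fun y => g (Fin.cons a y)) (x ∘ σ) = (fun y => g (Fin.cons a y)) x := by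
        intro σ x
        -- This permutation fixes `0` and acts as `σ` on the remaining coordinates.
        have := hs (Equiv.Perm.decomposeFin.symm (0, σ)) (Fin.cons a x)
        simp only
        rw [← this]
        congr 1
        ext i
        refine Fin.cases ?_ (fun i => ?_) i
        · simp
        · simp
      have hma : Measurable fun y : Fin n → ℝ => g (Fin.cons a y) := by
        refine hg.comp (measurable_pi_lambda _ fun i => ?_)
        refine Fin.cases ?_ (fun i => ?_) i
        · simp
        · simpa using measurable_pi_apply i
      have h := ih ha.2 hma hsa
      -- The weight factors into the density of the first arrival at `a` and the weight of the
      -- inductive hypothesis on `(a, 1]`.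
      have he : Real.exp (-(Λ * (1 - t))) * Λ ^ (n + 1) =
          (Λ * Real.exp (-(Λ * (a - t)))) * (Real.exp (-(Λ * (1 - a))) * Λ ^ n) := by
        have : -(Λ * (1 - t)) = -(Λ * (a - t)) + -(Λ * (1 - a)) := by ring
        rw [this, Real.exp_add]; ring
      rw [he, ENNReal.ofReal_mul (by positivity), mul_assoc, h]
      ring
    have hmc : Measurable fun a : ℝ => ENNReal.ofReal (Λ * Real.exp (-(Λ * (a - t)))) * J a := by
      fun_prop
    calc ENNReal.ofReal (Real.exp (-(Λ * (1 - t))) * Λ ^ (n + 1)) * (((n + 1 : ℕ) : ℝ≥0∞) *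
          ∫⁻ a in Set.Ioc t 1, ∫⁻ y, g (Fin.cons a y)
            ∂(Measure.pi fun _ : Fin n => volume.restrict (Set.Ioc a 1)))
        = ((n + 1 : ℕ) : ℝ≥0∞) * ∫⁻ a in Set.Ioc t 1,
            ENNReal.ofReal (Real.exp (-(Λ * (1 - t))) * Λ ^ (n + 1)) * ∫⁻ y, g (Fin.cons a y)
            ∂(Measure.pi fun _ : Fin n => volume.restrict (Set.Ioc a 1)) := by
          rw [lintegral_const_mul' _ _ ENNReal.ofReal_ne_top]; ring
      _ = ((n + 1 : ℕ) : ℝ≥0∞) * ∫⁻ a in Set.Ioc t 1,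
            (n.factorial : ℝ≥0∞) * (ENNReal.ofReal (Λ * Real.exp (-(Λ * (a - t)))) * J a) := by
          rw [setLIntegral_congr_fun measurableSet_Ioc hkey]
      _ = _ := by
          rw [lintegral_const_mul _ hmc]; push_cast; ring

/-- A symmetric functional of `n` independent uniform points, weighted by the Poisson probability of
`n` points, expressed through arrival times. -/
theorem poisson_mul_lintegral_symmetric {Λ : ℝ≥0} (hΛ : 0 < Λ) (n : ℕ)
    {g : (Fin n → ℝ) → ℝ≥0∞} (hg : Measurable g)
    (hs : ∀ (σ : Equiv.Perm (Fin n)) x, g (x ∘ σ) = g x) :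
    poissonMeasure Λ {n} * ∫⁻ x, g x ∂(Measure.pi fun _ => volume.restrict (Set.Ioc (0:ℝ) 1)) =
      ∫⁻ e, (countEvent Λ 0 n).indicator (fun e => g fun i => arrival (i + 1) e / Λ) e
        ∂waiting := by
  have h := lintegral_symmetric_eq_arrival (Λ := Λ) (by exact_mod_cast hΛ) n
    (zero_le_one' ℝ) hg hs
  simp only [zero_add, sub_zero, mul_one] at h
  have hf : (n.factorial : ℝ≥0∞) ≠ 0 := by exact_mod_cast n.factorial_ne_zero
  rw [poissonMeasure_singleton, ENNReal.ofReal_div_of_pos (by positivity), ENNReal.ofReal_natCast,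
    ENNReal.div_eq_inv_mul, mul_assoc, h, ← mul_assoc,
    ENNReal.inv_mul_cancel hf (ENNReal.natCast_ne_top _), one_mul]

/-! ### The tail quantile function -/

section Quantile

variable {μ : Measure ℝ}

theorem tail_nonneg (μ : Measure ℝ) (t : ℝ) : 0 ≤ tail μ t := measureReal_nonneg

theorem tail_antitone (μ : Measure ℝ) [IsFiniteMeasure μ] : Antitone (tail μ) :=
  fun _ _ h => measureReal_mono (Set.Ioi_subset_Ioi h)

theorem tail_le_one (μ : Measure ℝ) [IsProbabilityMeasure μ] (t : ℝ) : tail μ t ≤ 1 :=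
  measureReal_le_one

theorem tail_eq_one_sub_cdf (μ : Measure ℝ) [IsProbabilityMeasure μ] (t : ℝ) :
    tail μ t = 1 - cdf μ t := by
  rw [cdf_eq_real, ← probReal_compl_eq_one_sub measurableSet_Iic, Set.compl_Iic]
  rfl

theorem tendsto_tail_atTop (μ : Measure ℝ) [IsProbabilityMeasure μ] :
    Tendsto (tail μ) atTop (𝓝 0) := by
  have h : tail μ = fun t => 1 - cdf μ t := funext (tail_eq_one_sub_cdf μ)
  rw [h]
  simpa using (tendsto_cdf_atTop μ).const_sub 1

/-- Right continuity of the distribution function. It is what makes the infimum defining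
`tailQuantile` attained. -/
theorem tail_le_of_forall_gt [IsProbabilityMeasure μ] {t v : ℝ} (h : ∀ s, t < s → tail μ s ≤ v) :
    tail μ t ≤ v := by
  have h1 : Tendsto (tail μ) (𝓝[>] t) (𝓝 (tail μ t)) := by
    have h : tail μ = fun t => 1 - cdf μ t := funext (tail_eq_one_sub_cdf μ)
    rw [h]
    exact (((cdf μ).right_continuous t).mono_left (nhdsWithin_mono _ Set.Ioi_subset_Ici_self)).const_sub 1
  exact le_of_tendsto h1 (by filter_upwards [self_mem_nhdsWithin] with s hs using h s hs)

/-- The tail quantile function: the least `t ≥ 0` at which the tail of `μ` is at most `v`. -/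
noncomputable def tailQuantile (μ : Measure ℝ) (v : ℝ) : ℝ :=
  if 0 < v then sInf {t | 0 ≤ t ∧ tail μ t ≤ v} else 0

theorem tailQuantile_nonneg (μ : Measure ℝ) (v : ℝ) : 0 ≤ tailQuantile μ v := by
  unfold tailQuantile
  split_ifs
  · exact Real.sInf_nonneg fun t ht => ht.1
  · exact le_rfl

/-- The Galois connection between tail and quantile; all later inversions go through it. -/
theorem tailQuantile_le_iff [IsProbabilityMeasure μ] {v t : ℝ} (hv : 0 < v) (ht : 0 ≤ t) :
    tailQuantile μ v ≤ t ↔ tail μ t ≤ v := by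
  have hbdd : BddBelow {t | 0 ≤ t ∧ tail μ t ≤ v} := ⟨0, fun s hs => hs.1⟩
  have hne : {t | 0 ≤ t ∧ tail μ t ≤ v}.Nonempty := by
    obtain ⟨s, hs, hs0⟩ := (((tendsto_tail_atTop μ).eventually (ge_mem_nhds hv)).and
      (eventually_ge_atTop 0)).exists
    exact ⟨s, hs0, hs⟩
  rw [tailQuantile, if_pos hv]
  constructor
  · intro h
    refine tail_le_of_forall_gt fun s hs => ?_
    obtain ⟨r, hr, hrs⟩ := (csInf_lt_iff hbdd hne).1 (h.trans_lt hs)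
    exact (tail_antitone μ hrs.le).trans hr.2
  · intro h
    exact csInf_le hbdd ⟨ht, h⟩

theorem lt_tailQuantile_iff [IsProbabilityMeasure μ] {v t : ℝ} (hv : 0 < v) (ht : 0 ≤ t) :
    t < tailQuantile μ v ↔ v < tail μ t := by
  rw [← not_le, tailQuantile_le_iff hv ht, not_le]

theorem tailQuantile_antitoneOn [IsProbabilityMeasure μ] :
    AntitoneOn (tailQuantile μ) (Set.Ioi 0) := by
  intro v hv w hw hvw
  rw [tailQuantile_le_iff hw (tailQuantile_nonneg μ v)]
  exact ((tailQuantile_le_iff hv (tailQuantile_nonneg μ v)).1 le_rfl).trans hvw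

/-- Arrivals beyond `1` thus carry no power, so the infinite series over arrivals only sees the
points in `(0, 1)`. -/
theorem tailQuantile_eq_zero [IsProbabilityMeasure μ] {v : ℝ} (hv : 1 ≤ v) :
    tailQuantile μ v = 0 :=
  le_antisymm ((tailQuantile_le_iff (by linarith) le_rfl).2 ((tail_le_one μ 0).trans hv))
    (tailQuantile_nonneg μ v)

@[fun_prop] theorem measurable_tailQuantile [IsProbabilityMeasure μ] :
    Measurable (tailQuantile μ) := by
  refine measurable_of_Iic fun t => ?_
  rcases lt_or_ge t 0 with ht | ht
  · convert MeasurableSet.empty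
    ext v
    simpa using ht.trans_le (tailQuantile_nonneg μ v)
  · have : tailQuantile μ ⁻¹' Set.Iic t = Set.Iic 0 ∪ (Set.Ioi 0 ∩ Set.Ici (tail μ t)) := by
      ext v
      simp only [Set.mem_preimage, Set.mem_Iic, Set.mem_union, Set.mem_inter_iff, Set.mem_Ioi,
        Set.mem_Ici]
      rcases le_or_gt v 0 with hv | hv
      · simp [hv, tailQuantile, not_lt.2 hv, ht]
      · simp [hv, not_le.2 hv, tailQuantile_le_iff hv ht]
    rw [this]
    exact measurableSet_Iic.union (measurableSet_Ioi.inter measurableSet_Ici)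

instance isProbabilityMeasure_uniform :
    IsProbabilityMeasure (volume.restrict (Set.Ioc (0:ℝ) 1)) :=
  ⟨by simp⟩

/-- Inverse transform sampling: for `t ≥ 0`, the quantile is at most `t` exactly on the part of `(0,
1]` at or above `tail μ t`, which has length `cdf μ t`. -/
theorem map_tailQuantile [IsProbabilityMeasure μ] (hμ : μ (Set.Iio 0) = 0) :
    (volume.restrict (Set.Ioc (0:ℝ) 1)).map (tailQuantile μ) = μ := by
  have := Measure.isProbabilityMeasure_map (μ := volume.restrict (Set.Ioc (0:ℝ) 1))
    (measurable_tailQuantile (μ := μ)).aemeasurable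
  refine Measure.ext_of_Iic _ _ fun t => ?_
  rw [Measure.map_apply measurable_tailQuantile measurableSet_Iic]
  rcases lt_or_ge t 0 with ht | ht
  · rw [measure_mono_null (Set.Iic_subset_Iio.2 ht) hμ]
    convert measure_empty (μ := volume.restrict (Set.Ioc (0:ℝ) 1))
    ext v
    simpa using ht.trans_le (tailQuantile_nonneg μ v)
  · rw [Measure.restrict_apply (measurable_tailQuantile measurableSet_Iic)]
    have h1 : tailQuantile μ ⁻¹' Set.Iic t ∩ Set.Ioc 0 1 = Set.Ioc 0 1 ∩ Set.Ici (tail μ t) := by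
      ext v
      simp only [Set.mem_inter_iff, Set.mem_preimage, Set.mem_Iic, Set.mem_Ici]
      rw [and_comm]
      refine and_congr_right fun hv => tailQuantile_le_iff hv.1 ht
    have h2 : (volume : Measure ℝ) (Set.Ioc 0 1 ∩ Set.Ici (tail μ t)) =
        ENNReal.ofReal (1 - tail μ t) := by
      refine le_antisymm ?_ ?_
      · refine (measure_mono (t := Set.Icc (tail μ t) 1) fun v hv => ⟨hv.2, hv.1.2⟩).trans ?_
        rw [Real.volume_Icc]
      · rw [← Real.volume_Ioc]
        exact measure_mono fun v hv => ⟨⟨(tail_nonneg μ t).trans_lt hv.1, hv.2⟩, hv.1.le⟩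
    rw [h1, h2, tail_eq_one_sub_cdf, sub_sub_cancel, cdf_eq_real, ofReal_measureReal]

/-! ### Asymptotic inversion of regularly varying tails. -/

theorem tendsto_tailQuantile_zero [IsProbabilityMeasure μ] (hpos : ∀ x, 0 < x → 0 < tail μ x) :
    Tendsto (tailQuantile μ) (𝓝[>] 0) atTop := by
  refine tendsto_atTop.2 fun b => ?_
  have hb : 0 < tail μ (max b 1) := hpos _ (by positivity)
  filter_upwards [Ioo_mem_nhdsGT hb] with v hv
  exact (le_max_left b 1).trans ((lt_tailQuantile_iff hv.1 (by positivity)).2 hv.2).le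

/-- Just below the quantile at `v` the tail exceeds `v`; regular variation then puts the tail at `c`
times the quantile above `u * v`. -/
theorem RegularlyVarying.eventually_mul_tailQuantile_le [IsProbabilityMeasure μ] {α : ℝ}
    (h : RegularlyVarying (tail μ) (-α)) {c u : ℝ} (hc : 0 < c) (hu : 0 < u)
    (hcu : u < c ^ (-α)) :
    ∀ᶠ v in 𝓝[>] 0, c * tailQuantile μ v ≤ tailQuantile μ (u * v) := by
  -- The slack `η > 1` is needed because the tail at the quantile itself may have jumped below `v`;
  -- dividing by `η` moves strictly before the jump.
  obtain ⟨η, hη1, hη⟩ : ∃ η : ℝ, 1 < η ∧ u < (c * η) ^ (-α) := by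
    have hcont : ContinuousAt (fun x : ℝ => (c * x) ^ (-α)) 1 :=
      ContinuousAt.rpow_const (by fun_prop) (Or.inl (by simpa using hc.ne'))
    have := (hcont.eventually (lt_mem_nhds (by simpa using hcu))).filter_mono
      (nhdsWithin_le_nhds (s := Set.Ioi 1))
    obtain ⟨η, h1, h2⟩ := (this.and self_mem_nhdsWithin).exists
    exact ⟨η, h2, h1⟩
  have hη0 : 0 < η := by linarith
  obtain ⟨X, hX⟩ := eventually_atTop.1 ((h.2.2 (c * η) (by positivity)).eventually (lt_mem_nhds hη))
  filter_upwards [(tendsto_tailQuantile_zero h.1).eventually_gt_atTop (max 0 (η * X)),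
    self_mem_nhdsWithin] with v hv hv0
  have hG : 0 < tailQuantile μ v := (le_max_left _ _).trans_lt hv
  have hs0 : 0 < tailQuantile μ v / η := by positivity
  have hsX : X ≤ tailQuantile μ v / η := by
    rw [le_div_iff₀ hη0, mul_comm]
    exact ((le_max_right _ _).trans_lt hv).le
  have h1 := hX _ hsX
  have h2 : v < tail μ (tailQuantile μ v / η) :=
    (lt_tailQuantile_iff hv0 hs0.le).1 (div_lt_self hG hη1)
  rw [lt_div_iff₀ (h.1 _ hs0)] at h1
  have h3 : c * η * (tailQuantile μ v / η) = c * tailQuantile μ v := by field_simp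
  rw [h3] at h1
  refine ((lt_tailQuantile_iff (mul_pos hu hv0) (by positivity)).2 ?_).le
  exact (mul_lt_mul_of_pos_left h2 hu).trans h1

/-- No slack is needed in this direction, as the tail at the quantile of `v` is at most `v`. -/
theorem RegularlyVarying.eventually_tailQuantile_le_mul [IsProbabilityMeasure μ] {α : ℝ}
    (h : RegularlyVarying (tail μ) (-α)) {c u : ℝ} (hc : 0 < c) (hu : 0 < u)
    (hcu : c ^ (-α) < u) :
    ∀ᶠ v in 𝓝[>] 0, tailQuantile μ (u * v) ≤ c * tailQuantile μ v := by
  obtain ⟨X, hX⟩ := eventually_atTop.1 ((h.2.2 c hc).eventually (gt_mem_nhds hcu))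
  filter_upwards [(tendsto_tailQuantile_zero h.1).eventually_gt_atTop (max 0 X),
    self_mem_nhdsWithin] with v hv hv0
  have hG : 0 < tailQuantile μ v := (le_max_left _ _).trans_lt hv
  have h1 := hX _ ((le_max_right _ _).trans_lt hv).le
  rw [div_lt_iff₀ (h.1 _ hG)] at h1
  rw [tailQuantile_le_iff (mul_pos hu hv0) (by positivity)]
  exact h1.le.trans (mul_le_mul_of_nonneg_left
    ((tailQuantile_le_iff hv0 hG.le).1 le_rfl) hu.le)

theorem RegularlyVarying.tendsto_tailQuantile_ratio [IsProbabilityMeasure μ] {α : ℝ}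
    (hα : 0 < α) (h : RegularlyVarying (tail μ) (-α)) {a : ℝ} (ha : 0 < a) :
    Tendsto (fun v => tailQuantile μ (a * v) / tailQuantile μ v) (𝓝[>] 0)
      (𝓝 (a ^ (-(1 / α)))) := by
  have hL : 0 < a ^ (-(1 / α)) := Real.rpow_pos_of_pos ha _
  have hLa : (a ^ (-(1 / α))) ^ (-α) = a := by
    rw [← Real.rpow_mul ha.le]
    have : -(1 / α) * -α = 1 := by field_simp
    rw [this, Real.rpow_one]
  have hpos := (tendsto_tailQuantile_zero h.1).eventually_gt_atTop 0
  refine tendsto_order.2 ⟨fun l hl => ?_, fun l hl => ?_⟩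
  · obtain ⟨c, hc1, hc2⟩ := exists_between (max_lt hl hL)
    have hc0 : 0 < c := (le_max_right _ _).trans_lt hc1
    have : a < c ^ (-α) := by
      conv_lhs => rw [← hLa]
      exact Real.rpow_lt_rpow_of_neg hc0 hc2 (by linarith)
    filter_upwards [h.eventually_mul_tailQuantile_le hc0 ha this, hpos] with v hv hp
    exact ((le_max_left _ _).trans_lt hc1).trans_le ((le_div_iff₀ hp).2 hv)
  · obtain ⟨c, hc1, hc2⟩ := exists_between hl
    have hc0 : 0 < c := hL.trans hc1
    have : c ^ (-α) < a := by
      conv_rhs => rw [← hLa]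
      exact Real.rpow_lt_rpow_of_neg hL hc1 (by linarith)
    filter_upwards [h.eventually_tailQuantile_le_mul hc0 ha this, hpos] with v hv hp
    exact ((div_le_iff₀ hp).2 hv).trans_lt hc2

theorem tendsto_const_mul_nhdsGT_zero {a : ℝ} (ha : 0 < a) :
    Tendsto (fun v : ℝ => a * v) (𝓝[>] 0) (𝓝[>] 0) := by
  refine tendsto_nhdsWithin_iff.2 ⟨?_, ?_⟩
  · have : Tendsto (fun v : ℝ => a * v) (𝓝 0) (𝓝 (a * 0)) := by
      apply Continuous.tendsto; fun_prop
    rw [mul_zero] at this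
    exact this.mono_left nhdsWithin_le_nhds
  · filter_upwards [self_mem_nhdsWithin] with v hv using mul_pos ha hv

/-- At index zero the comparison holds for every factor `c` as soon as `u < 1`. It is applied at `a
* v` with `u = a⁻¹` and `c = 2 / ε`. -/
theorem RegularlyVarying.tendsto_tailQuantile_ratio_zero [IsProbabilityMeasure μ]
    (h : RegularlyVarying (tail μ) 0) {a : ℝ} (ha : 1 < a) :
    Tendsto (fun v => tailQuantile μ (a * v) / tailQuantile μ v) (𝓝[>] 0) (𝓝 0) := by
  have ha0 : 0 < a := by linarith
  have hpos := (tendsto_tailQuantile_zero h.1).eventually_gt_atTop 0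
  rw [← neg_zero] at h
  refine tendsto_order.2 ⟨fun l hl => Eventually.of_forall fun v => hl.trans_le
    (div_nonneg (tailQuantile_nonneg _ _) (tailQuantile_nonneg _ _)), fun ε hε => ?_⟩
  have h1 := h.eventually_mul_tailQuantile_le (c := 2 / ε) (u := a⁻¹) (by positivity)
    (by positivity) (by simpa using inv_lt_one_of_one_lt₀ ha)
  filter_upwards [(tendsto_const_mul_nhdsGT_zero ha0).eventually h1, hpos] with v hv hp
  rw [inv_mul_cancel_left₀ ha0.ne'] at hv
  have h2 : tailQuantile μ (a * v) ≤ ε / 2 * tailQuantile μ v := by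
    calc tailQuantile μ (a * v) = ε / 2 * (2 / ε * tailQuantile μ (a * v)) := by field_simp
      _ ≤ _ := by gcongr
  exact ((div_le_iff₀ hp).2 h2).trans_lt (by linarith)

/-! ### Power bounds -/

/-- Iterate along powers of two up to `2 ^ k ≤ a < 2 ^ (k + 1)`; monotonicity covers the gap, and
the extra factor `2 ^ γ` pays for the rounding. -/
theorem antitone_le_rpow_mul_of_halving {f : ℝ → ℝ} {γ v₀ : ℝ} (hγ : 0 < γ)
    (hanti : AntitoneOn f (Set.Ioi 0)) (h0 : ∀ v, 0 ≤ f v)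
    (hf : ∀ v, 0 < v → v ≤ v₀ → 2 ^ γ * f v ≤ f (v / 2)) {a v : ℝ} (hv : 0 < v) (ha : 1 ≤ a)
    (hav : a * v ≤ v₀) : f (a * v) ≤ 2 ^ γ * a ^ (-γ) * f v := by
  have hiter : ∀ k : ℕ, 2 ^ k * v ≤ v₀ → (2 ^ k : ℝ) ^ γ * f (2 ^ k * v) ≤ f v := by
    intro k
    induction k with
    | zero => intro _; simp
    | succ k ih =>
      intro hk
      have hle : (2:ℝ) ^ k * v ≤ 2 ^ (k + 1) * v := by
        rw [pow_succ]; nlinarith [pow_pos (two_pos : (0:ℝ) < 2) k, mul_pos (pow_pos (two_pos : (0:ℝ) < 2) k) hv]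
      refine le_trans ?_ (ih (hle.trans hk))
      have := hf (2 ^ (k + 1) * v) (by positivity) hk
      have h2 : (2:ℝ) ^ (k + 1) * v / 2 = 2 ^ k * v := by rw [pow_succ]; ring
      rw [h2] at this
      rw [pow_succ (2:ℝ) k, Real.mul_rpow (by positivity) (by positivity), mul_assoc,
        ← pow_succ]
      gcongr
  obtain ⟨k, hk1, hk2⟩ := exists_nat_pow_near ha (one_lt_two)
  have h1 : 2 ^ k * v ≤ a * v := by gcongr
  have h2 : f (a * v) ≤ f (2 ^ k * v) := hanti (by simp; positivity) (by simp; positivity) h1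
  have h3 := hiter k (h1.trans hav)
  have h4 : (1:ℝ) ≤ 2 ^ γ * a ^ (-γ) * (2 ^ k : ℝ) ^ γ := by
    have h5 : a ^ γ ≤ 2 ^ γ * (2 ^ k : ℝ) ^ γ := by
      rw [← Real.mul_rpow (by positivity) (by positivity), ← pow_succ']
      exact Real.rpow_le_rpow (by linarith) hk2.le hγ.le
    have h6 : 0 < a ^ γ := Real.rpow_pos_of_pos (by linarith) _
    rw [Real.rpow_neg (by linarith), mul_right_comm, ← div_eq_mul_inv, le_div_iff₀ h6, one_mul]
    exact h5
  calc f (a * v) ≤ 1 * f (2 ^ k * v) := by rw [one_mul]; exact h2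
    _ ≤ 2 ^ γ * a ^ (-γ) * (2 ^ k : ℝ) ^ γ * f (2 ^ k * v) :=
        mul_le_mul_of_nonneg_right h4 (h0 _)
    _ = 2 ^ γ * a ^ (-γ) * ((2 ^ k : ℝ) ^ γ * f (2 ^ k * v)) := by ring
    _ ≤ _ := by
        have : 0 ≤ a ^ (-γ) := Real.rpow_nonneg (by linarith) _
        gcongr

theorem antitone_le_rpow_mul_of_doubling {f : ℝ → ℝ} {κ v₀ : ℝ} (hκ : 0 < κ)
    (hanti : AntitoneOn f (Set.Ioi 0)) (h0 : ∀ v, 0 ≤ f v)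
    (hf : ∀ v, 0 < v → v ≤ v₀ → f (v / 2) ≤ 2 ^ κ * f v) {a v : ℝ} (hv : 0 < v) (ha : 1 ≤ a)
    (hav : a * v ≤ v₀) : f v ≤ 2 ^ κ * a ^ κ * f (a * v) := by
  have ha0 : 0 < a := by linarith
  have hiter : ∀ k : ℕ, f (a * v / 2 ^ k) ≤ (2 ^ k : ℝ) ^ κ * f (a * v) := by
    intro k
    induction k with
    | zero => simp
    | succ k ih =>
      have h1 : a * v / 2 ^ k ≤ v₀ := by
        refine (div_le_self (by positivity) (one_le_pow₀ (by norm_num))).trans hav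
      have := hf (a * v / 2 ^ k) (by positivity) h1
      have h2 : a * v / 2 ^ k / 2 = a * v / 2 ^ (k + 1) := by rw [pow_succ, div_div]
      rw [h2] at this
      rw [pow_succ', Real.mul_rpow (by positivity) (by positivity), mul_assoc, ← pow_succ']
      exact this.trans (by gcongr)
  obtain ⟨k, hk1, hk2⟩ := exists_nat_pow_near ha (one_lt_two)
  have h1 : a * v / 2 ^ (k + 1) ≤ v := by
    rw [div_le_iff₀ (by positivity), mul_comm]; gcongr
  have h2 : f v ≤ f (a * v / 2 ^ (k + 1)) := hanti (by simp; positivity) (by simpa using hv) h1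
  have h3 : ((2:ℝ) ^ (k + 1)) ^ κ ≤ 2 ^ κ * a ^ κ := by
    rw [← Real.mul_rpow (by positivity) (by positivity), pow_succ']
    gcongr
  exact h2.trans ((hiter (k + 1)).trans (mul_le_mul_of_nonneg_right h3 (h0 _)))

/-- A Potter-type bound. The exponent above `1`, available since `α < 1`, makes the powers of the
arrivals summable relative to the first one. -/
theorem RegularlyVarying.exists_tailQuantile_decay [IsProbabilityMeasure μ] {α : ℝ} (hα : 0 ≤ α)
    (hα1 : α < 1) (h : RegularlyVarying (tail μ) (-α)) :
    ∃ γ C v₁ : ℝ, 1 < γ ∧ 0 < C ∧ 0 < v₁ ∧ ∀ v a : ℝ, 0 < v → v ≤ v₁ → 1 ≤ a →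
      tailQuantile μ (a * v) ≤ C * a ^ (-γ) * tailQuantile μ v := by
  -- Chosen so that `1 < γ` and `γ * α < 1`; the latter permits the halving estimate with factor `2
  -- ^ γ`.
  set γ : ℝ := 2 / (1 + α) with hγ
  have hγ1 : 1 < γ := by rw [hγ, lt_div_iff₀ (by linarith)]; linarith
  have hγα : γ * α < 1 := by
    rw [hγ, div_mul_eq_mul_div, div_lt_one (by linarith)]; linarith
  have h1 : (1 / 2 : ℝ) < (2 ^ γ : ℝ) ^ (-α) := by
    rw [← Real.rpow_mul (by norm_num), one_div, ← Real.rpow_neg_one]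
    exact Real.rpow_lt_rpow_of_exponent_lt (by norm_num) (by linarith)
  have h2 := h.eventually_mul_tailQuantile_le (c := 2 ^ γ) (u := 1 / 2) (by positivity)
    (by norm_num) h1
  obtain ⟨w, hw0, hw⟩ := (mem_nhdsGT_iff_exists_Ioc_subset).1 h2
  have hw0 : 0 < w := hw0
  set v₀ := min w 1 with hv₀
  have hv₀0 : 0 < v₀ := lt_min hw0 one_pos
  have hv₀1 : v₀ ≤ 1 := min_le_right _ _
  have hhalf : ∀ v, 0 < v → v ≤ v₀ → 2 ^ γ * tailQuantile μ v ≤ tailQuantile μ (v / 2) := by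
    intro v hv hv2
    have := hw ⟨hv, hv2.trans (min_le_left _ _)⟩
    have h3 : 2 ^ γ * tailQuantile μ v ≤ tailQuantile μ (1 / 2 * v) := this
    rwa [show 1 / 2 * v = v / 2 by ring] at h3
  have hv₀γ : 1 ≤ v₀ ^ (-γ) := Real.one_le_rpow_of_pos_of_le_one_of_nonpos hv₀0 hv₀1 (by linarith)
  refine ⟨γ, 2 ^ γ * v₀ ^ (-γ), v₀, hγ1, by positivity, hv₀0, fun v a hv hv1 ha => ?_⟩
  have ha0 : 0 < a := by linarith
  have hG := tailQuantile_nonneg μ v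
  rcases le_or_gt (a * v) v₀ with hle | hgt
  · refine (antitone_le_rpow_mul_of_halving (by linarith) tailQuantile_antitoneOn
      (tailQuantile_nonneg μ) hhalf hv ha hle).trans ?_
    have : (2:ℝ) ^ γ * a ^ (-γ) * 1 ≤ 2 ^ γ * a ^ (-γ) * v₀ ^ (-γ) := by gcongr
    refine mul_le_mul_of_nonneg_right (le_of_le_of_eq (by simpa using this) (by ring)) hG
  · rcases le_or_gt 1 (a * v) with h1 | h1
    · rw [tailQuantile_eq_zero h1]; positivity
    -- Here `a * v` lies between `v₀` and `1`. Comparing with the value at `v₀` costs only `v₀ ^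
    -- (-γ)`, since `v₀ / v ≥ v₀ * a`.
    · have h3 : tailQuantile μ (a * v) ≤ tailQuantile μ v₀ :=
        tailQuantile_antitoneOn hv₀0 (hv₀0.trans hgt) hgt.le
      have h4 := antitone_le_rpow_mul_of_halving (by linarith) tailQuantile_antitoneOn
        (tailQuantile_nonneg μ) hhalf hv (a := v₀ / v) ((one_le_div hv).2 hv1)
        (by rw [div_mul_cancel₀ _ hv.ne'])
      rw [div_mul_cancel₀ _ hv.ne'] at h4
      have h5 : (v₀ / v) ^ (-γ) ≤ v₀ ^ (-γ) * a ^ (-γ) := by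
        rw [← Real.mul_rpow hv₀0.le ha0.le]
        refine Real.rpow_le_rpow_of_nonpos (by positivity) ?_ (by linarith)
        rw [le_div_iff₀ hv, mul_assoc]
        nlinarith
      refine h3.trans (h4.trans (mul_le_mul_of_nonneg_right ?_ hG))
      rw [mul_assoc]; gcongr

/-- The opposite Potter-type bound, used to dominate the rate. The first estimate compares two
points near the origin; the second serves when the larger one is not near it. -/
theorem RegularlyVarying.exists_tailQuantile_growth [IsProbabilityMeasure μ] {α : ℝ} (hα : 0 < α)
    (h : RegularlyVarying (tail μ) (-α)) :
    ∃ κ C v₁ : ℝ, 0 < κ ∧ 0 < C ∧ 0 < v₁ ∧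
      (∀ v w : ℝ, 0 < v → v ≤ w → w ≤ v₁ →
        tailQuantile μ v ≤ C * (w / v) ^ κ * tailQuantile μ w) ∧
      ∀ v : ℝ, 0 < v → tailQuantile μ v ≤ C * v ^ (-κ) := by
  -- Any exponent above `1 / α` would do; this one gives `(2 ^ κ) ^ (-α) = 1 / 4`.
  set κ : ℝ := 2 / α with hκ
  have hκ0 : 0 < κ := by positivity
  have h1 : (2 ^ κ : ℝ) ^ (-α) < 1 / 2 := by
    rw [← Real.rpow_mul (by norm_num), one_div, ← Real.rpow_neg_one]
    refine Real.rpow_lt_rpow_of_exponent_lt (by norm_num) ?_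
    have : κ * -α = -2 := by rw [hκ]; field_simp
    rw [this]; norm_num
  have h2 := h.eventually_tailQuantile_le_mul (c := 2 ^ κ) (u := 1 / 2) (by positivity)
    (by norm_num) h1
  obtain ⟨w, hw0, hw⟩ := (mem_nhdsGT_iff_exists_Ioc_subset).1 h2
  have hw0 : 0 < w := hw0
  set v₀ := min w 1 with hv₀
  have hv₀0 : 0 < v₀ := lt_min hw0 one_pos
  have hv₀1 : v₀ ≤ 1 := min_le_right _ _
  have hdbl : ∀ v, 0 < v → v ≤ v₀ → tailQuantile μ (v / 2) ≤ 2 ^ κ * tailQuantile μ v := by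
    intro v hv hv2
    have h3 : tailQuantile μ (1 / 2 * v) ≤ 2 ^ κ * tailQuantile μ v :=
      hw ⟨hv, hv2.trans (min_le_left _ _)⟩
    rwa [show 1 / 2 * v = v / 2 by ring] at h3
  have hmain : ∀ v w : ℝ, 0 < v → v ≤ w → w ≤ v₀ →
      tailQuantile μ v ≤ 2 ^ κ * (w / v) ^ κ * tailQuantile μ w := by
    intro v w hv hvw hw
    have := antitone_le_rpow_mul_of_doubling hκ0 tailQuantile_antitoneOn
        (tailQuantile_nonneg μ) hdbl hv (a := w / v) ((one_le_div hv).2 hvw)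
        (by rwa [div_mul_cancel₀ _ hv.ne'])
    rwa [div_mul_cancel₀ _ hv.ne'] at this
  have hg := tailQuantile_nonneg μ v₀
  refine ⟨κ, 2 ^ κ * (1 + tailQuantile μ v₀), v₀, hκ0, by positivity, hv₀0, ?_, ?_⟩
  · intro v w hv hvw hw
    have hw' := tailQuantile_nonneg μ w
    have hwv : 0 ≤ w / v := div_nonneg (hv.le.trans hvw) hv.le
    refine (hmain v w hv hvw hw).trans (mul_le_mul_of_nonneg_right ?_ hw')
    have : 0 ≤ (w / v) ^ κ := Real.rpow_nonneg hwv _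
    have h2κ : (0:ℝ) < 2 ^ κ := by positivity
    nlinarith [mul_nonneg (mul_nonneg h2κ.le this) hg]
  · intro v hv
    have h2κ : (1:ℝ) ≤ 2 ^ κ := Real.one_le_rpow (by norm_num) hκ0.le
    rcases le_or_gt 1 v with h1 | h1
    · rw [tailQuantile_eq_zero h1]; positivity
    · have hvκ : 1 ≤ v ^ (-κ) :=
        Real.one_le_rpow_of_pos_of_le_one_of_nonpos hv h1.le (by linarith)
      rcases le_or_gt v v₀ with h3 | h3
      · have h4 := hmain v v₀ hv h3 le_rfl
        have h5 : (v₀ / v) ^ κ ≤ v ^ (-κ) := by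
          rw [Real.rpow_neg hv.le, ← Real.inv_rpow hv.le]
          refine Real.rpow_le_rpow (by positivity) ?_ hκ0.le
          rw [div_eq_mul_inv]
          exact mul_le_of_le_one_left (by positivity) hv₀1
        calc tailQuantile μ v ≤ 2 ^ κ * (v₀ / v) ^ κ * tailQuantile μ v₀ := h4
          _ ≤ 2 ^ κ * v ^ (-κ) * (1 + tailQuantile μ v₀) := by gcongr; linarith
          _ = _ := by ring
      · have h4 : tailQuantile μ v ≤ tailQuantile μ v₀ :=
          tailQuantile_antitoneOn hv₀0 hv h3.le
        calc tailQuantile μ v ≤ 1 * (1 + tailQuantile μ v₀) * 1 := by linarith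
          _ ≤ _ := by gcongr

end Quantile

/-! ### From the network to independent received powers -/

/-- The signal-to-interference-plus-noise ratio from the strongest of `n` received powers. -/
noncomputable def sinrOf (W : ℝ) {n : ℕ} (p : Fin n → ℝ) : ℝ :=
  ⨆ i, p i / ((∑ j ∈ Finset.univ.erase i, p j) + W)

@[fun_prop] theorem measurable_sinrOf (W : ℝ) (n : ℕ) :
    Measurable fun p : Fin n → ℝ => sinrOf W p := by
  unfold sinrOf
  exact Measurable.iSup fun i => by fun_prop

theorem sinrOf_comp_perm (W : ℝ) {n : ℕ} (p : Fin n → ℝ) (σ : Equiv.Perm (Fin n)) :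
    sinrOf W (p ∘ σ) = sinrOf W p := by
  unfold sinrOf
  have h : ∀ i, ∑ j ∈ Finset.univ.erase i, (p ∘ σ) j = ∑ j ∈ Finset.univ.erase (σ i), p j := by
    intro i
    rw [Finset.sum_erase_eq_sub (Finset.mem_univ _), Finset.sum_erase_eq_sub (Finset.mem_univ _)]
    simp only [Function.comp]
    rw [Equiv.sum_comp σ]
  simp only [h]
  exact Equiv.iSup_comp (g := fun i => p i / ((∑ j ∈ Finset.univ.erase i, p j) + W)) σ

namespace Pathloss

variable {d : ℕ} (L : Pathloss d)

theorem R_nonneg : ∀ k, k ≤ L.K → 0 ≤ L.R k := by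
  intro k
  induction k with
  | zero => intro _; rw [L.R_zero]
  | succ k ih => intro h; exact (ih (by omega)).trans (L.R_lt k (by omega)).le

theorem Rinf_pos : 0 < L.Rinf := by
  obtain ⟨k, hk⟩ : ∃ k, L.K = k + 1 := ⟨L.K - 1, by have := L.one_le_K; omega⟩
  rw [Rinf, hk]
  exact (L.R_nonneg k (by omega)).trans_lt (L.R_lt k (by omega))

theorem volume_domain_ne_zero : volume L.domain ≠ 0 :=
  (Metric.measure_ball_pos volume 0 L.Rinf_pos).ne'

theorem volume_domain_ne_top : volume L.domain ≠ ⊤ := measure_ball_lt_top.ne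

theorem volume_domain_toNNReal_pos : 0 < (volume L.domain).toNNReal :=
  ENNReal.toNNReal_pos L.volume_domain_ne_zero L.volume_domain_ne_top

instance isProbabilityMeasure_cond_domain :
    IsProbabilityMeasure (cond volume L.domain) :=
  cond_isProbabilityMeasure_of_finite L.volume_domain_ne_zero L.volume_domain_ne_top

instance isProbabilityMeasure_nodeLaw (F : Measure ℝ) [IsProbabilityMeasure F] :
    IsProbabilityMeasure (L.nodeLaw F) := by
  unfold nodeLaw; infer_instance

@[fun_prop] theorem measurable_loss : Measurable L.loss := by
  unfold loss
  refine Finset.measurable_sum _ fun k _ => ?_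
  exact Measurable.indicator (by fun_prop) measurableSet_Ico

@[fun_prop] theorem measurable_power : Measurable L.power := by
  unfold power; fun_prop

instance isProbabilityMeasure_powerLaw (F : Measure ℝ) [IsProbabilityMeasure F] :
    IsProbabilityMeasure (L.powerLaw F) :=
  Measure.isProbabilityMeasure_map L.measurable_power.aemeasurable

theorem loss_term_nonneg {k : ℕ} (hk : k < L.K) {r : ℝ} (hr : 0 ≤ r) :
    0 ≤ (Set.Ico (L.R k) (L.R (k + 1))).indicator (fun s => L.A k * s ^ L.β k) r :=
  Set.indicator_apply_nonneg fun _ => mul_nonneg (L.A_pos k hk).le (Real.rpow_nonneg hr _)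

theorem loss_nonneg {r : ℝ} (hr : 0 ≤ r) : 0 ≤ L.loss r :=
  Finset.sum_nonneg fun _ hk => L.loss_term_nonneg (Finset.mem_range.1 hk) hr

theorem loss_pos {r : ℝ} (hr : 0 < r) (hR : r < L.Rinf) : 0 < L.loss r := by
  have hex : ∃ k, r < L.R k := ⟨L.K, hR⟩
  classical
  have hk := Nat.find_spec hex
  have hk0 : Nat.find hex ≠ 0 := by
    intro h
    rw [h, L.R_zero] at hk
    exact lt_asymm hr hk
  obtain ⟨j, hj⟩ := Nat.exists_eq_succ_of_ne_zero hk0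
  have hjK : j < L.K := by
    have := Nat.find_min' hex hR
    omega
  have hjR : L.R j ≤ r := not_lt.1 (Nat.find_min hex (by omega : j < Nat.find hex))
  rw [hj] at hk
  refine Finset.sum_pos' (fun i hi => L.loss_term_nonneg (Finset.mem_range.1 hi) hr.le)
    ⟨j, Finset.mem_range.2 hjK, ?_⟩
  rw [Set.indicator_of_mem (Set.mem_Ico.2 ⟨hjR, hk⟩)]
  exact mul_pos (L.A_pos j hjK) (Real.rpow_pos_of_pos hr _)

theorem powerLaw_Iio_zero {F : Measure ℝ} [IsProbabilityMeasure F] (hF : F (Set.Iio 0) = 0) :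
    L.powerLaw F (Set.Iio 0) = 0 := by
  rw [powerLaw, Measure.map_apply L.measurable_power measurableSet_Iio]
  refine measure_mono_null (t := Set.univ ×ˢ Set.Iio 0) ?_ ?_
  · intro z hz
    refine ⟨trivial, ?_⟩
    by_contra h
    exact absurd hz (not_lt.2 (div_nonneg (not_lt.1 h) (L.loss_nonneg (norm_nonneg _))))
  · rw [nodeLaw, Measure.prod_prod, hF, mul_zero]

theorem powerLaw_Ioi_zero (hd : 1 ≤ d) {F : Measure ℝ} [IsProbabilityMeasure F]
    (hF : F (Set.Ioi 0) ≠ 0) : L.powerLaw F (Set.Ioi 0) ≠ 0 := by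
  have : Nonempty (Fin d) := ⟨⟨0, hd⟩⟩
  rw [powerLaw, Measure.map_apply L.measurable_power measurableSet_Ioi]
  intro h
  -- The origin is removed because the pathloss may vanish there, and division by zero gives power
  -- zero. It is null as `1 ≤ d`.
  have hsub : (L.domain \ {0}) ×ˢ Set.Ioi (0:ℝ) ⊆ L.power ⁻¹' Set.Ioi 0 := by
    rintro ⟨x, m⟩ ⟨⟨hx, hx0⟩, hm⟩
    have h1 : ‖x‖ < L.Rinf := by simpa [domain] using hx
    exact div_pos hm (L.loss_pos (norm_pos_iff.2 hx0) h1)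
  have h2 := measure_mono_null hsub h
  rw [nodeLaw, Measure.prod_prod, mul_eq_zero, or_iff_left hF] at h2
  have h3 : cond volume L.domain (L.domain \ {0}) = 1 := by
    have h4 : cond volume L.domain {0} = 0 := cond_absolutelyContinuous (by simp)
    rw [measure_sdiff_null h4, cond_apply_self L.volume_domain_ne_zero L.volume_domain_ne_top]
  rw [h3] at h2
  exact one_ne_zero h2

theorem sinr_eq_sinrOf (W : ℝ) (ω : Config d) :
    L.sinr W ω = sinrOf W fun i : Fin ω.1 => L.power (ω.2 i) := by
  unfold sinr sinrOf quality
  congr 1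
  ext i
  rw [Finset.sum_erase_eq_sub (Finset.mem_univ _),
    Finset.sum_erase_eq_sub (Finset.mem_range.2 i.2),
    ← Fin.sum_univ_eq_sum_range (fun j => L.power (ω.2 j))]

@[fun_prop] theorem measurable_sinr (W : ℝ) : Measurable (L.sinr W) := by
  refine measurable_from_prod_countable_right fun n => ?_
  simp only [L.sinr_eq_sinrOf]
  exact (measurable_sinrOf W n).comp (measurable_pi_lambda _ fun i =>
    L.measurable_power.comp (measurable_pi_apply _))

theorem lintegral_network (F : Measure ℝ) [IsProbabilityMeasure F] (W : ℝ) (lam : ℝ≥0)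
    {Φ : ℝ → ℝ≥0∞} (hΦ : Measurable Φ) :
    ∫⁻ ω, Φ (L.sinr W ω) ∂(L.network F lam) =
      ∑' n : ℕ, poissonMeasure (lam * (volume L.domain).toNNReal) {n} *
        ∫⁻ p, Φ (sinrOf W p) ∂(Measure.pi fun _ : Fin n => L.powerLaw F) := by
  rw [network, lintegral_prod _ (Measurable.aemeasurable (by fun_prop)), lintegral_countable']
  refine tsum_congr fun n => ?_
  rw [mul_comm]
  congr 1
  have h1 : (Measure.infinitePi fun _ : ℕ => L.nodeLaw F).map
      (fun z (i : Fin n) => L.power (z i)) = Measure.pi fun _ : Fin n => L.powerLaw F := by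
    rw [← map_infinitePi_fin (L.powerLaw F) n]
    have : (Measure.infinitePi fun _ : ℕ => L.powerLaw F) =
        (Measure.infinitePi fun _ : ℕ => L.nodeLaw F).map (fun z i => L.power (z i)) := by
      rw [Measure.infinitePi_map_pi (f := fun _ => L.power) _ fun _ => L.measurable_power]
      rfl
    rw [this, Measure.map_map (by fun_prop) (by fun_prop)]
    rfl
  rw [← h1, lintegral_map (by fun_prop) (by fun_prop)]
  simp only [L.sinr_eq_sinrOf]

end Pathloss

/-! ### The signal quality through arrival times -/

theorem ae_waiting_pos : ∀ᵐ e ∂waiting, ∀ i, 0 < e i := by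
  rw [ae_all_iff]
  intro i
  exact (measurePreserving_eval_infinitePi (fun _ : ℕ => expLaw) i).quasiMeasurePreserving.ae
    ae_pos_expLaw

/-- The strong law for waiting times truncated to `[0, 1]`: truncation makes integrability immediate
and can only lower the sums, and only a lower bound is wanted. -/
theorem ae_waiting_linear_growth :
    ∀ᵐ e ∂waiting, ∃ c : ℝ, 0 < c ∧ ∀ᶠ n : ℕ in atTop, c * n ≤ arrival n e := by
  set X : ℕ → (ℕ → ℝ) → ℝ := fun i e => max 0 (min (e i) 1) with hX
  have hXm : ∀ i, Measurable (X i) := fun i => by simp only [hX]; fun_prop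
  have hφ : Measurable fun x : ℝ => max 0 (min x 1) := by fun_prop
  have hint : ∀ i, Integrable (X i) waiting := fun i =>
    Integrable.of_bound (hXm i).aestronglyMeasurable 1 (ae_of_all _ fun e => by
      rw [Real.norm_eq_abs, abs_of_nonneg (le_max_left _ _)]
      exact max_le zero_le_one (min_le_right _ _))
  have hindep : iIndepFun X waiting :=
    iIndepFun_infinitePi (P := fun _ : ℕ => expLaw) (X := fun _ x => max 0 (min x 1)) fun _ => hφ
  have hident : ∀ i, IdentDistrib (X i) (X 0) waiting waiting := by
    intro i
    have h : IdentDistrib (fun e : ℕ → ℝ => e i) (fun e => e 0) waiting waiting :=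
      ⟨(measurable_pi_apply i).aemeasurable, (measurable_pi_apply 0).aemeasurable, by
        rw [waiting, Measure.infinitePi_map_eval, Measure.infinitePi_map_eval]⟩
    exact h.comp hφ
  have hlaw := strong_law_ae_real X (hint 0) (fun i j hij => hindep.indepFun hij) hident
  have hmean : 0 < ∫ e, X 0 e ∂waiting := by
    rw [integral_pos_iff_support_of_nonneg (f := X 0) (fun e => le_max_left _ _) (hint 0)]
    have : ∀ᵐ e ∂waiting, e ∈ Function.support (X 0) := by
      filter_upwards [ae_waiting_pos] with e he
      have : 0 < X 0 e := lt_max_of_lt_right (lt_min (he 0) one_pos)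
      exact this.ne'
    rw [prob_compl_eq_zero_iff₀ (μ := waiting) (s := Function.support (X 0))
      (measurableSet_support (hXm 0)).nullMeasurableSet |>.1 this]
    exact one_pos
  filter_upwards [hlaw, ae_waiting_pos] with e he hpos
  refine ⟨(∫ e, X 0 e ∂waiting) / 2, by positivity, ?_⟩
  filter_upwards [he.eventually (lt_mem_nhds (half_lt_self hmean)), eventually_gt_atTop 0]
    with n hn hn0
  have hn0' : (0:ℝ) < n := by exact_mod_cast hn0
  rw [lt_div_iff₀ hn0'] at hn
  exact hn.le.trans (Finset.sum_le_sum fun i _ => max_le (hpos i).le (min_le_left _ _))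

theorem arrival_strictMono {e : ℕ → ℝ} (he : ∀ i, 0 < e i) : StrictMono fun k => arrival k e :=
  strictMono_nat_of_lt_succ fun k => by rw [arrival_succ]; linarith [he k]

theorem arrival_pos {e : ℕ → ℝ} (he : ∀ i, 0 < e i) (k : ℕ) : 0 < arrival (k + 1) e := by
  simpa using arrival_strictMono he (Nat.succ_pos k)

theorem tendsto_arrival {e : ℕ → ℝ}
    (h : ∃ c : ℝ, 0 < c ∧ ∀ᶠ n : ℕ in atTop, c * n ≤ arrival n e) :
    Tendsto (fun n => arrival n e) atTop atTop := by
  obtain ⟨c, hc, h⟩ := h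
  exact tendsto_atTop_mono' _ h (tendsto_natCast_atTop_atTop.const_mul_atTop hc)

/-- The interference from all points but the first, when the points are the arrival times sped up by
`Λ` and a point at `v` has power `G v`. -/
noncomputable def arrivalInterference (G : ℝ → ℝ) (Λ : ℝ) (e : ℕ → ℝ) : ℝ :=
  ∑' i, G (arrival (i + 2) e / Λ)

/-- The signal quality of the first point, when the points are the arrival times sped up by
`Λ` and a point at `v` has power `G v`. -/
noncomputable def arrivalSinr (G : ℝ → ℝ) (W Λ : ℝ) (e : ℕ → ℝ) : ℝ :=
  G (arrival 1 e / Λ) / (arrivalInterference G Λ e + W)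

theorem measurable_arrivalSinr {G : ℝ → ℝ} (hG : Measurable G) (W Λ : ℝ) :
    Measurable (arrivalSinr G W Λ) := by
  have : Measurable (arrivalInterference G Λ) :=
    Measurable.tsum fun i => by fun_prop
  unfold arrivalSinr
  fun_prop

/-- The first arrival has both the largest power and the least interference, so the maximum is
attained there. Arrivals after the `n`-th lie beyond `1` and add nothing to the series; for `n = 0`
both sides are zero. -/
theorem sinrOf_arrival {G : ℝ → ℝ} {W Λ : ℝ} {e : ℕ → ℝ} {n : ℕ} (hW : 0 < W) (hΛ : 0 < Λ)
    (hanti : AntitoneOn G (Set.Ioi 0)) (h0 : ∀ v, 0 ≤ G v) (h1 : ∀ v, 1 ≤ v → G v = 0)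
    (he : ∀ i, 0 < e i) (hn : e ∈ countEvent Λ 0 n) :
    sinrOf W (fun i : Fin n => G (arrival (i + 1) e / Λ)) = arrivalSinr G W Λ e := by
  have hmono : ∀ j k, j ≤ k → arrival j e / Λ ≤ arrival k e / Λ := fun j k hjk =>
    div_le_div_of_nonneg_right ((arrival_strictMono he).monotone hjk) hΛ.le
  have hzero : ∀ k, n + 1 ≤ k → G (arrival k e / Λ) = 0 := by
    intro k hk
    refine h1 _ (le_trans ?_ (hmono _ _ hk))
    simpa using hn.2.le
  cases n with
  | zero =>
    rw [sinrOf, Real.iSup_of_isEmpty, arrivalSinr, hzero 1 le_rfl, zero_div]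
  | succ m =>
    have hI : arrivalInterference G Λ e =
        (∑ j : Fin (m + 1), G (arrival (j + 1) e / Λ)) - G (arrival 1 e / Λ) := by
      rw [Fin.sum_univ_succ, arrivalInterference,
        tsum_eq_sum (s := Finset.range m) (fun i hi => hzero _ (by
          have := Finset.mem_range.not.1 hi; omega)),
        ← Fin.sum_univ_eq_sum_range (fun i => G (arrival (i + 2) e / Λ))]
      simp
    set S := ∑ j : Fin (m + 1), G (arrival (j + 1) e / Λ) with hS
    have hle : ∀ i : Fin (m + 1), G (arrival (i + 1) e / Λ) ≤ G (arrival 1 e / Λ) := by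
      intro i
      refine hanti ?_ ?_ (hmono _ _ (by omega))
      · exact div_pos (arrival_pos he 0) hΛ
      · exact div_pos (arrival_pos he _) hΛ
    have hleS : ∀ i : Fin (m + 1), G (arrival (i + 1) e / Λ) ≤ S := fun i =>
      Finset.single_le_sum (f := fun j : Fin (m + 1) => G (arrival (j + 1) e / Λ))
        (fun j _ => h0 _) (Finset.mem_univ i)
    have hq : ∀ i : Fin (m + 1), ∑ j ∈ Finset.univ.erase i, G (arrival (j + 1) e / Λ) =
        S - G (arrival (i + 1) e / Λ) := fun i =>
      Finset.sum_erase_eq_sub (Finset.mem_univ _)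
    rw [sinrOf, arrivalSinr, hI]
    simp only [hq]
    refine le_antisymm (ciSup_le fun i => ?_) ?_
    · refine div_le_div₀ (h0 _) (hle i) ?_ ?_
      · have := hleS 0
        simp only [Fin.val_zero, zero_add] at this
        linarith
      · linarith [hle i]
    · have := le_ciSup (f := fun i : Fin (m + 1) => G (arrival (i + 1) e / Λ) /
        (S - G (arrival (i + 1) e / Λ) + W)) (Set.finite_range _).bddAbove 0
      simpa using this

theorem ae_exists_mem_countEvent {Λ : ℝ} (hΛ : 0 < Λ) :
    ∀ᵐ e ∂waiting, e ∈ ⋃ n, countEvent Λ 0 n := by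
  filter_upwards [ae_waiting_linear_growth] with e he
  have hex : ∃ n, Λ < arrival n e := ((tendsto_arrival he).eventually_gt_atTop Λ).exists
  classical
  have hk0 : Nat.find hex ≠ 0 := by
    intro h
    have := Nat.find_spec hex
    rw [h, arrival_zero] at this
    exact lt_asymm hΛ this
  obtain ⟨n, hn⟩ := Nat.exists_eq_succ_of_ne_zero hk0
  refine Set.mem_iUnion.2 ⟨n, ?_, ?_⟩
  · have := Nat.find_min hex (by omega : n < Nat.find hex)
    simpa [div_le_one hΛ] using this
  · have := Nat.find_spec hex
    rw [hn] at this
    simpa [one_lt_div hΛ] using this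

/-- The coupling of all positive densities on one space. Each Poisson-weighted term becomes an
integral over the event of `n` arrivals in `(0, 1]`, and these events partition the space up to a
null set. -/
theorem Pathloss.lintegral_network_eq_waiting {d : ℕ} (L : Pathloss d) {F : Measure ℝ}
    [IsProbabilityMeasure F] (hF : F (Set.Iio 0) = 0) {W : ℝ} (hW : 0 < W) {lam : ℝ≥0}
    (hlam : 0 < lam) {Φ : ℝ → ℝ≥0∞} (hΦ : Measurable Φ) :
    ∫⁻ ω, Φ (L.sinr W ω) ∂(L.network F lam) =
      ∫⁻ e, Φ (arrivalSinr (tailQuantile (L.powerLaw F)) W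
        (lam * (volume L.domain).toNNReal : ℝ≥0) e) ∂waiting := by
  set G := tailQuantile (L.powerLaw F) with hG
  set Λ : ℝ≥0 := lam * (volume L.domain).toNNReal with hΛ
  have hΛ0 : 0 < Λ := mul_pos hlam L.volume_domain_toNNReal_pos
  have hΛr : (0:ℝ) < Λ := by exact_mod_cast hΛ0
  have hGm : Measurable G := measurable_tailQuantile
  rw [L.lintegral_network F W lam hΦ]
  have hterm : ∀ n : ℕ, poissonMeasure Λ {n} *
      ∫⁻ p, Φ (sinrOf W p) ∂(Measure.pi fun _ : Fin n => L.powerLaw F) =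
      ∫⁻ e in countEvent Λ 0 n, Φ (arrivalSinr G W Λ e) ∂waiting := by
    intro n
    have hmap : (Measure.pi fun _ : Fin n => L.powerLaw F) =
        (Measure.pi fun _ : Fin n => volume.restrict (Set.Ioc (0:ℝ) 1)).map
          (fun u i => G (u i)) := by
      have hQ : (volume.restrict (Set.Ioc (0:ℝ) 1)).map G = L.powerLaw F :=
        map_tailQuantile (L.powerLaw_Iio_zero hF)
      rw [← Measure.infinitePi_eq_pi, ← Measure.infinitePi_eq_pi,
        Measure.infinitePi_map_pi (f := fun _ => G) _ fun _ => hGm]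
      simp only [hQ]
    rw [hmap, lintegral_map (by fun_prop) (by fun_prop),
      poisson_mul_lintegral_symmetric hΛ0 n (g := fun u => Φ (sinrOf W fun i => G (u i)))
        (by fun_prop) (fun σ x => by
          have := sinrOf_comp_perm W (fun i => G (x i)) σ
          simp only [Function.comp_def] at this ⊢
          rw [this]),
      ← lintegral_indicator (measurableSet_countEvent _ _ _)]
    refine lintegral_congr_ae ?_
    filter_upwards [ae_waiting_pos] with e he
    by_cases h : e ∈ countEvent Λ 0 n
    · rw [Set.indicator_of_mem h, Set.indicator_of_mem h, sinrOf_arrival hW hΛr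
        tailQuantile_antitoneOn (tailQuantile_nonneg _) (fun v => tailQuantile_eq_zero) he h]
    · rw [Set.indicator_of_notMem h, Set.indicator_of_notMem h]
  rw [tsum_congr hterm]
  have hae : ∀ᵐ e ∂waiting, ∀ m n, m ≠ n → ¬ (e ∈ countEvent Λ 0 m ∧ e ∈ countEvent Λ 0 n) := by
    filter_upwards [ae_waiting_pos] with e he m n hmn ⟨hm, hn⟩
    wlog hlt : m < n generalizing m n
    · exact this n m hmn.symm hn hm (lt_of_le_of_ne (not_lt.1 hlt) hmn.symm)
    have h1 := hm.2
    have h2 := hn.1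
    have h3 : arrival (m + 1) e / Λ ≤ arrival n e / Λ :=
      div_le_div_of_nonneg_right ((arrival_strictMono he).monotone hlt) hΛr.le
    linarith
  rw [← lintegral_iUnion₀ (fun n => (measurableSet_countEvent _ _ _).nullMeasurableSet),
    Measure.restrict_eq_self_of_ae_mem (ae_exists_mem_countEvent hΛr)]
  intro m n hmn
  refine measure_mono_null (t := {e | ¬ ∀ m n, m ≠ n →
    ¬ (e ∈ countEvent Λ 0 m ∧ e ∈ countEvent Λ 0 n)}) (fun e he h => h m n hmn he) hae

/-! ### Limits at high density -/

theorem summable_arrival_rpow {e : ℕ → ℝ}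
    (hgrow : ∃ c : ℝ, 0 < c ∧ ∀ᶠ n : ℕ in atTop, c * n ≤ arrival n e) {s : ℝ} (hs : 1 < s) :
    Summable fun n : ℕ => arrival n e ^ (-s) := by
  obtain ⟨c, hc, h⟩ := hgrow
  have h1 : Summable fun n : ℕ => c ^ (-s) * (n : ℝ) ^ (-s) :=
    (Real.summable_nat_rpow.2 (by linarith)).mul_left _
  refine Summable.of_norm_bounded_eventually_nat h1 ?_
  filter_upwards [h, eventually_gt_atTop 0] with n hn hn0
  have hn0' : (0:ℝ) < n := by exact_mod_cast hn0
  have : 0 < c * n := by positivity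
  rw [Real.norm_eq_abs, abs_of_nonneg (Real.rpow_nonneg (this.le.trans hn) _),
    ← Real.mul_rpow hc.le hn0'.le]
  exact Real.rpow_le_rpow_of_nonpos this hn (by linarith)

/-- The limit at high density of the interference over the power of the first point, when powers
have asymptotic ratio `r`. -/
noncomputable def limitInterference (r : ℝ → ℝ) (e : ℕ → ℝ) : ℝ :=
  ∑' i, r (arrival (i + 2) e / arrival 1 e)

theorem one_lt_arrival_ratio {e : ℕ → ℝ} (he : ∀ i, 0 < e i) (i : ℕ) :
    1 < arrival (i + 2) e / arrival 1 e :=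
  (one_lt_div (arrival_pos he 0)).2 (arrival_strictMono he (by omega))

theorem tendsto_div_atTop_nhdsGT_zero {a : ℝ} (ha : 0 < a) :
    Tendsto (fun Λ : ℝ => a / Λ) atTop (𝓝[>] 0) := by
  refine tendsto_nhdsWithin_iff.2 ⟨tendsto_const_nhds.div_atTop tendsto_id, ?_⟩
  filter_upwards [eventually_gt_atTop 0] with Λ hΛ using div_pos ha hΛ

/-- Dominated convergence for series at `v = A_1 / Λ`, with ratios `a = A_{i+2} / A_1`: each term
converges by `hr` and is bounded by `C a ^ (-γ)`, summable by linear growth. The noise drops out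
because `G` blows up at the origin. -/
theorem tendsto_arrivalInterference_ratio {G r : ℝ → ℝ} {γ C v₁ W : ℝ} (hγ : 1 < γ)
    (hv₁ : 0 < v₁) (h0 : ∀ v, 0 ≤ G v) (hGtop : Tendsto G (𝓝[>] 0) atTop)
    (hdecay : ∀ v a : ℝ, 0 < v → v ≤ v₁ → 1 ≤ a → G (a * v) ≤ C * a ^ (-γ) * G v)
    (hr : ∀ a, 1 < a → Tendsto (fun v => G (a * v) / G v) (𝓝[>] 0) (𝓝 (r a)))
    {e : ℕ → ℝ} (he : ∀ i, 0 < e i)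
    (hgrow : ∃ c : ℝ, 0 < c ∧ ∀ᶠ n : ℕ in atTop, c * n ≤ arrival n e) :
    Tendsto (fun Λ => (arrivalInterference G Λ e + W) / G (arrival 1 e / Λ)) atTop
      (𝓝 (limitInterference r e)) := by
  have hA := arrival_pos he 0
  have hv := tendsto_div_atTop_nhdsGT_zero hA
  have hmul : ∀ (i : ℕ) (Λ : ℝ), arrival (i + 2) e / Λ =
      arrival (i + 2) e / arrival 1 e * (arrival 1 e / Λ) := by
    intro i Λ
    rw [div_mul_div_cancel₀ hA.ne']
  have hsum : Summable fun i : ℕ => C * (arrival (i + 2) e / arrival 1 e) ^ (-γ) := by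
    have h1 := (summable_nat_add_iff 2).2 (summable_arrival_rpow hgrow hγ)
    refine ((h1.mul_right (arrival 1 e ^ (-γ))⁻¹).mul_left C).congr fun i => ?_
    rw [Real.div_rpow (arrival_pos he _).le hA.le, div_eq_mul_inv]
  have hlim : Tendsto (fun Λ => ∑' i, G (arrival (i + 2) e / Λ) / G (arrival 1 e / Λ)) atTop
      (𝓝 (limitInterference r e)) := by
    refine tendsto_tsum_of_dominated_convergence hsum (fun i => ?_) ?_
    · refine ((hr _ (one_lt_arrival_ratio he i)).comp hv).congr fun Λ => ?_
      rw [Function.comp_apply, ← hmul i Λ]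
    · have h2 : ∀ᶠ Λ in atTop, arrival 1 e / Λ ∈ Set.Ioc 0 v₁ :=
        hv.eventually (Ioc_mem_nhdsGT hv₁)
      filter_upwards [h2, hv.eventually (hGtop.eventually_gt_atTop 0)] with Λ hΛ hpos i
      rw [Real.norm_eq_abs, abs_of_nonneg (div_nonneg (h0 _) (h0 _)), div_le_iff₀ hpos, hmul i Λ]
      exact hdecay _ _ hΛ.1 hΛ.2 (one_lt_arrival_ratio he i).le
  have hW : Tendsto (fun Λ => W / G (arrival 1 e / Λ)) atTop (𝓝 0) :=
    tendsto_const_nhds.div_atTop (hGtop.comp hv)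
  have := hlim.add hW
  rw [add_zero] at this
  refine this.congr fun Λ => ?_
  rw [tsum_div_const, add_div]
  rfl

theorem tendsto_mul_coe_atTop {c : ℝ≥0} (hc : 0 < c) :
    Tendsto (fun lam : ℝ≥0 => ((lam * c : ℝ≥0) : ℝ)) atTop atTop := by
  simp only [NNReal.coe_mul]
  exact (NNReal.tendsto_coe_atTop.2 tendsto_id).atTop_mul_const (by exact_mod_cast hc)

/-! ### Coverage and rate as functionals of the waiting times. -/

namespace Pathloss

variable {d : ℕ} (L : Pathloss d)

/-- The mean number of nodes at density `lam`. -/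
noncomputable def meanCount (lam : ℝ≥0) : ℝ := (lam * (volume L.domain).toNNReal : ℝ≥0)

theorem tendsto_meanCount : Tendsto L.meanCount atTop atTop :=
  tendsto_mul_coe_atTop L.volume_domain_toNNReal_pos

/-- The signal quality of the strongest node at density `lam`, as a function of the waiting
times. -/
noncomputable def waitingSinr (F : Measure ℝ) (W : ℝ) (lam : ℝ≥0) : (ℕ → ℝ) → ℝ :=
  arrivalSinr (tailQuantile (L.powerLaw F)) W (L.meanCount lam)

@[fun_prop] theorem measurable_waitingSinr {F : Measure ℝ} [IsProbabilityMeasure F] (W : ℝ) (lam : ℝ≥0) :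
    Measurable (L.waitingSinr F W lam) :=
  measurable_arrivalSinr measurable_tailQuantile _ _

theorem waitingSinr_nonneg (F : Measure ℝ) {W : ℝ} (hW : 0 < W) (lam : ℝ≥0) (e : ℕ → ℝ) :
    0 ≤ L.waitingSinr F W lam e :=
  div_nonneg (tailQuantile_nonneg _ _)
    (add_nonneg (tsum_nonneg fun _ => tailQuantile_nonneg _ _) hW.le)

variable {F : Measure ℝ} [IsProbabilityMeasure F]

theorem rate_eq_waiting (hF : F (Set.Iio 0) = 0) {W : ℝ} (hW : 0 < W) {lam : ℝ≥0}
    (hlam : 0 < lam) : L.rate F W lam =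
      ∫⁻ e, ENNReal.ofReal (Real.log (1 + L.waitingSinr F W lam e)) ∂waiting :=
  L.lintegral_network_eq_waiting hF hW hlam (Φ := fun s => ENNReal.ofReal (Real.log (1 + s)))
    (by fun_prop)

theorem coverage_eq_waiting (hF : F (Set.Iio 0) = 0) {W : ℝ} (hW : 0 < W) (y : ℝ) {lam : ℝ≥0}
    (hlam : 0 < lam) :
    L.coverage F W y lam = waiting.real {e | y ≤ L.waitingSinr F W lam e} := by
  have h := L.lintegral_network_eq_waiting hF hW hlam (Φ := (Set.Ici y).indicator 1)
    (measurable_one.indicator measurableSet_Ici)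
  have h1 : (fun ω => (Set.Ici y).indicator (1 : ℝ → ℝ≥0∞) (L.sinr W ω)) =
      {ω | y ≤ L.sinr W ω}.indicator 1 := rfl
  have h2 : (fun e => (Set.Ici y).indicator (1 : ℝ → ℝ≥0∞) (L.waitingSinr F W lam e)) =
      {e | y ≤ L.waitingSinr F W lam e}.indicator 1 := rfl
  change ∫⁻ ω, (fun ω => (Set.Ici y).indicator (1 : ℝ → ℝ≥0∞) (L.sinr W ω)) ω ∂_ =
    ∫⁻ e, (fun e => (Set.Ici y).indicator (1 : ℝ → ℝ≥0∞) (L.waitingSinr F W lam e)) e ∂_ at h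
  rw [h1, h2, lintegral_indicator_one (measurableSet_le measurable_const (L.measurable_sinr W)),
    lintegral_indicator_one (measurableSet_le measurable_const (L.measurable_waitingSinr W lam))]
    at h
  rw [coverage, measureReal_def, h, measureReal_def]

theorem tendsto_coverage_of_ae (hF : F (Set.Iio 0) = 0) {W : ℝ} (hW : 0 < W) (y : ℝ)
    {S : Set (ℕ → ℝ)} (hS : MeasurableSet S)
    (h : ∀ᵐ e ∂waiting, ∀ᶠ lam in atTop, y ≤ L.waitingSinr F W lam e ↔ e ∈ S) :
    Tendsto (L.coverage F W y) atTop (𝓝 (waiting.real S)) := by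
  have h1 : Tendsto (fun lam => waiting {e | y ≤ L.waitingSinr F W lam e}) atTop
      (𝓝 (waiting S)) :=
    tendsto_measure_of_ae_tendsto_indicator_of_isFiniteMeasure atTop hS
      (fun lam => measurableSet_le measurable_const (L.measurable_waitingSinr W lam)) h
  refine ((ENNReal.tendsto_toReal (measure_ne_top _ _)).comp h1).congr' ?_
  filter_upwards [eventually_gt_atTop 0] with lam hlam
  rw [L.coverage_eq_waiting hF hW y hlam]
  rfl

/-- Markov's inequality. It serves twice: high coverage forces a large rate, and a vanishing rate
forces vanishing coverage. -/
theorem ofReal_log_mul_coverage_le_rate (W : ℝ) {y : ℝ} (hy : 0 < y) (lam : ℝ≥0) :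
    ENNReal.ofReal (Real.log (1 + y)) * ENNReal.ofReal (L.coverage F W y lam) ≤
      L.rate F W lam := by
  have hms : MeasurableSet {ω | y ≤ L.sinr W ω} :=
    measurableSet_le measurable_const (L.measurable_sinr W)
  unfold rate coverage
  rw [network, ofReal_measureReal, ← lintegral_indicator_const hms]
  refine lintegral_mono fun ω => ?_
  by_cases h : ω ∈ {ω | y ≤ L.sinr W ω}
  · rw [Set.indicator_of_mem h]
    have h' : y ≤ L.sinr W ω := h
    exact ENNReal.ofReal_le_ofReal (Real.log_le_log (by linarith) (by linarith))
  · rw [Set.indicator_of_notMem h]; exact zero_le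

/-! ### Slowly varying tails -/

/-- Stated for the inverse, so that the slowly varying case, where the signal quality diverges, is
covered as the limit `0`. -/
theorem tendsto_waitingSinr_inv {α : ℝ} (hα0 : 0 ≤ α) (hα1 : α < 1)
    (h : RegularlyVarying (tail (L.powerLaw F)) (-α)) {r : ℝ → ℝ}
    (hr : ∀ a, 1 < a → Tendsto (fun v => tailQuantile (L.powerLaw F) (a * v) /
      tailQuantile (L.powerLaw F) v) (𝓝[>] 0) (𝓝 (r a))) (W : ℝ) :
    ∀ᵐ e ∂waiting, Tendsto (fun lam => (L.waitingSinr F W lam e)⁻¹) atTop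
      (𝓝 (limitInterference r e)) := by
  obtain ⟨γ, C, v₁, hγ, -, hv₁, hdecay⟩ := h.exists_tailQuantile_decay hα0 hα1
  filter_upwards [ae_waiting_pos, ae_waiting_linear_growth] with e he hgrow
  have := (tendsto_arrivalInterference_ratio (W := W) hγ hv₁ (tailQuantile_nonneg _)
    (tendsto_tailQuantile_zero h.1) hdecay hr he hgrow).comp L.tendsto_meanCount
  refine this.congr fun lam => ?_
  rw [waitingSinr, arrivalSinr, inv_div]
  rfl

theorem eventually_waitingSinr_pos (h : ∀ x, 0 < x → 0 < tail (L.powerLaw F) x) {W : ℝ}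
    (hW : 0 < W) {e : ℕ → ℝ} (he : ∀ i, 0 < e i) :
    ∀ᶠ lam in atTop, 0 < L.waitingSinr F W lam e := by
  have h1 := ((tendsto_tailQuantile_zero h).comp
    ((tendsto_div_atTop_nhdsGT_zero (arrival_pos he 0)).comp L.tendsto_meanCount))
  filter_upwards [h1.eventually_gt_atTop 0] with lam hlam
  exact div_pos hlam (add_pos_of_nonneg_of_pos (tsum_nonneg fun _ => tailQuantile_nonneg _ _) hW)

theorem tendsto_coverage_of_slowlyVarying (hF : F (Set.Iio 0) = 0)
    (h : RegularlyVarying (tail (L.powerLaw F)) 0) {W : ℝ} (hW : 0 < W) (y : ℝ) :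
    Tendsto (L.coverage F W y) atTop (𝓝 1) := by
  have h' : RegularlyVarying (tail (L.powerLaw F)) (-0) := by rwa [neg_zero]
  have hlim := L.tendsto_waitingSinr_inv le_rfl one_pos h' (r := fun _ => 0)
    (fun a ha => h.tendsto_tailQuantile_ratio_zero ha) W
  have := L.tendsto_coverage_of_ae hF hW y (S := Set.univ) .univ ?_
  · simpa using this
  filter_upwards [hlim, ae_waiting_pos] with e he hpos
  have h0 : limitInterference (fun _ => 0) e = 0 := by simp [limitInterference]
  rw [h0] at he
  have h1 : Tendsto (fun lam => (L.waitingSinr F W lam e)⁻¹) atTop (𝓝[>] 0) := by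
    refine tendsto_nhdsWithin_iff.2 ⟨he, ?_⟩
    filter_upwards [L.eventually_waitingSinr_pos h.1 hW hpos] with lam hl using inv_pos.2 hl
  have h2 := tendsto_inv_nhdsGT_zero.comp h1
  filter_upwards [h2.eventually_ge_atTop y] with lam hl
  simpa using hl

theorem tendsto_rate_of_slowlyVarying (hF : F (Set.Iio 0) = 0)
    (h : RegularlyVarying (tail (L.powerLaw F)) 0) {W : ℝ} (hW : 0 < W) :
    Tendsto (L.rate F W) atTop (𝓝 ⊤) := by
  refine ENNReal.tendsto_nhds_top fun n => ?_
  -- With this threshold `log (1 + y) = n + 1`, strictly above the level `n` to be exceeded.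
  set y : ℝ := Real.exp (n + 1) - 1 with hy
  have hy0 : 0 < y := by
    have := Real.add_one_lt_exp (x := (n:ℝ) + 1) (by positivity)
    have : (0:ℝ) ≤ n := n.cast_nonneg
    linarith
  have h1 : Tendsto (fun lam => ENNReal.ofReal (Real.log (1 + y)) *
      ENNReal.ofReal (L.coverage F W y lam)) atTop (𝓝 (ENNReal.ofReal (Real.log (1 + y)) *
      ENNReal.ofReal 1)) :=
    ENNReal.Tendsto.const_mul (ENNReal.tendsto_ofReal
      (L.tendsto_coverage_of_slowlyVarying hF h hW y)) (Or.inr ENNReal.ofReal_ne_top)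
  have h2 : (n : ℝ≥0∞) < ENNReal.ofReal (Real.log (1 + y)) * ENNReal.ofReal 1 := by
    have : Real.log (1 + y) = n + 1 := by rw [hy]; simp
    rw [this, ENNReal.ofReal_one, mul_one, ← ENNReal.ofReal_natCast]
    exact (ENNReal.ofReal_lt_ofReal_iff (by positivity)).2 (by linarith)
  filter_upwards [h1.eventually (lt_mem_nhds h2)] with lam hl
  exact hl.trans_le (L.ofReal_log_mul_coverage_le_rate W hy0 lam)

end Pathloss

/-! ### Regularly varying tails: the limiting signal quality -/

theorem waiting_apply_seqCons {N : Set (ℕ → ℝ)} (hN : MeasurableSet N) :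
    waiting N = ∫⁻ e, expLaw {x | seqCons (x, e) ∈ N} ∂waiting := by
  have hpre : MeasurableSet (seqCons ⁻¹' N : Set (ℝ × (ℕ → ℝ))) := measurable_seqCons hN
  have h : waiting = (expLaw.prod waiting).map seqCons :=
    (map_seqCons_prod_infinitePi expLaw).symm
  conv_lhs => rw [h]
  rw [Measure.map_apply measurable_seqCons hN, Measure.prod_apply_symm hpre]
  rfl

section PowerRatio

variable {s : ℝ}

theorem limitInterference_seqCons (r : ℝ → ℝ) (x : ℝ) (e : ℕ → ℝ) :
    limitInterference r (seqCons (x, e)) = ∑' i, r ((x + arrival (i + 1) e) / x) := by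
  unfold limitInterference
  have h1 : arrival 1 (seqCons (x, e)) = x := by
    rw [show (1:ℕ) = 0 + 1 by rfl, arrival_succ_seqCons]; simp
  rw [h1]
  exact tsum_congr fun i => by rw [show i + 2 = (i + 1) + 1 by rfl, arrival_succ_seqCons]

theorem measurable_limitInterference {r : ℝ → ℝ} (hr : Measurable r) :
    Measurable (limitInterference r) := by
  unfold limitInterference
  exact Measurable.tsum fun i => by fun_prop

theorem rpow_add_div_le (hs : 0 < s) {x c : ℝ} (hx : 0 < x) (hc : 0 < c) :
    ((x + c) / x) ^ (-s) ≤ x ^ s * c ^ (-s) := by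
  have h1 : x ^ s * c ^ (-s) = (c / x) ^ (-s) := by
    rw [Real.div_rpow hc.le hx.le, Real.rpow_neg hx.le, div_inv_eq_mul, mul_comm]
  rw [h1]
  exact Real.rpow_le_rpow_of_nonpos (by positivity) (by gcongr; linarith) (by linarith)

theorem summable_rpow_add_div (hs : 1 < s) {x : ℝ} (hx : 0 < x) {e : ℕ → ℝ} (he : ∀ i, 0 < e i)
    (hgrow : ∃ c : ℝ, 0 < c ∧ ∀ᶠ n : ℕ in atTop, c * n ≤ arrival n e) :
    Summable fun i : ℕ => ((x + arrival (i + 1) e) / x) ^ (-s) := by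
  have h1 := ((summable_nat_add_iff 1).2 (summable_arrival_rpow hgrow hs)).mul_left (x ^ s)
  refine Summable.of_nonneg_of_le (fun i => ?_)
    (fun i => rpow_add_div_le (by linarith) hx (arrival_pos he i)) h1
  have := arrival_pos he i
  positivity

/-- A longer first waiting time, the others fixed, moves every ratio of arrivals closer to one.
Strictness is what rules out atoms of the limit. -/
theorem tsum_rpow_add_div_lt (hs : 1 < s) {x x' : ℝ} (hx : 0 < x) (hxx : x < x') {e : ℕ → ℝ}
    (he : ∀ i, 0 < e i)
    (hgrow : ∃ c : ℝ, 0 < c ∧ ∀ᶠ n : ℕ in atTop, c * n ≤ arrival n e) :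
    ∑' i : ℕ, ((x + arrival (i + 1) e) / x) ^ (-s) <
      ∑' i : ℕ, ((x' + arrival (i + 1) e) / x') ^ (-s) := by
  have hx' := hx.trans hxx
  have hterm : ∀ i : ℕ, ((x + arrival (i + 1) e) / x) ^ (-s) <
      ((x' + arrival (i + 1) e) / x') ^ (-s) := by
    intro i
    have hc := arrival_pos he i
    refine Real.rpow_lt_rpow_of_neg (by positivity) ?_ (by linarith)
    rw [add_div, add_div, div_self hx.ne', div_self hx'.ne']
    gcongr
  exact Summable.tsum_lt_tsum (i := 0) (fun i => (hterm i).le) (hterm 0)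
    (summable_rpow_add_div hs hx he hgrow) (summable_rpow_add_div hs hx' he hgrow)

/-- For fixed later waiting times, strict monotonicity lets the first one hit the level `c` at one
point at most, a null set for the exponential law. -/
theorem ae_limitInterference_rpow_ne (hs : 1 < s) (c : ℝ) :
    ∀ᵐ e ∂waiting, limitInterference (fun a => a ^ (-s)) e ≠ c := by
  have hm : MeasurableSet {e | limitInterference (fun a => a ^ (-s)) e = c} :=
    measurableSet_eq_fun (measurable_limitInterference (by fun_prop)) measurable_const
  have h0 : waiting {e | limitInterference (fun a => a ^ (-s)) e = c} = 0 := by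
    rw [waiting_apply_seqCons hm, lintegral_eq_zero_of_ae_eq_zero]
    filter_upwards [ae_waiting_pos, ae_waiting_linear_growth] with e he hgrow
    have hsub : ({x | seqCons (x, e) ∈ {e | limitInterference (fun a => a ^ (-s)) e = c}} ∩
        Set.Ioi 0).Subsingleton := by
      intro x hx x' hx'
      have h1 : limitInterference (fun a => a ^ (-s)) (seqCons (x, e)) = c := hx.1
      have h2 : limitInterference (fun a => a ^ (-s)) (seqCons (x', e)) = c := hx'.1
      rw [limitInterference_seqCons] at h1 h2
      rcases lt_trichotomy x x' with h | h | h
      · have := tsum_rpow_add_div_lt hs hx.2 h he hgrow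
        linarith
      · exact h
      · have := tsum_rpow_add_div_lt hs hx'.2 h he hgrow
        linarith
    have h3 := hsub.measure_zero expLaw
    have h4 : expLaw (Set.Ioi 0)ᶜ = 0 := ae_pos_expLaw
    refine measure_mono_null (t := ({x | seqCons (x, e) ∈
      {e | limitInterference (fun a => a ^ (-s)) e = c}} ∩ Set.Ioi 0) ∪ (Set.Ioi 0)ᶜ) ?_
      (measure_union_null h3 h4)
    intro x hx
    by_cases h : x ∈ Set.Ioi (0:ℝ)
    · exact Or.inl ⟨hx, h⟩
    · exact Or.inr h
  rw [ae_iff]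
  simpa using h0

/-- A short first waiting time `x` makes the first node dominate: the series is at most `x ^ s`
times a finite sum over the later arrivals. -/
theorem waiting_limitInterference_rpow_le_ne_zero (hs : 1 < s) {c : ℝ} (hc : 0 < c) :
    waiting {e | limitInterference (fun a => a ^ (-s)) e ≤ c} ≠ 0 := by
  have hm : MeasurableSet {e | limitInterference (fun a => a ^ (-s)) e ≤ c} :=
    measurableSet_le (measurable_limitInterference (by fun_prop)) measurable_const
  intro h0
  have hmp : MeasurableSet (seqCons ⁻¹' {e | limitInterference (fun a => a ^ (-s)) e ≤ c} :
      Set (ℝ × (ℕ → ℝ))) := measurable_seqCons hm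
  have hmeas : Measurable fun e => expLaw {x | seqCons (x, e) ∈
      {e | limitInterference (fun a => a ^ (-s)) e ≤ c}} := measurable_measure_prodMk_right hmp
  rw [waiting_apply_seqCons hm, lintegral_eq_zero_iff hmeas] at h0
  obtain ⟨e, ⟨h1, he⟩, hgrow⟩ :=
    ((h0.and ae_waiting_pos).and ae_waiting_linear_growth).exists
  set A : ℝ := ∑' i : ℕ, arrival (i + 1) e ^ (-s) with hA
  have hsA := (summable_nat_add_iff 1).2 (summable_arrival_rpow hgrow hs)
  have hA0 : 0 ≤ A := tsum_nonneg fun i => Real.rpow_nonneg (arrival_pos he i).le _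
  -- Solves `δ ^ s * (A + 1) = c`; the `+ 1` keeps the denominator positive.
  set δ : ℝ := (c / (A + 1)) ^ (1 / s) with hδ
  have hδ0 : 0 < δ := by positivity
  refine expLaw_Ioo_pos hδ0 (measure_mono_null ?_ h1)
  intro x hx
  have hx0 : 0 < x := hx.1
  change limitInterference (fun a => a ^ (-s)) (seqCons (x, e)) ≤ c
  rw [limitInterference_seqCons]
  have hs0 : 0 < s := by linarith
  have h2 : ∑' i : ℕ, ((x + arrival (i + 1) e) / x) ^ (-s) ≤ x ^ s * A := by
    rw [hA, ← tsum_mul_left]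
    exact Summable.tsum_le_tsum (fun i => rpow_add_div_le hs0 hx0 (arrival_pos he i))
      (summable_rpow_add_div hs hx0 he hgrow) (hsA.mul_left _)
  have h3 : x ^ s ≤ c / (A + 1) := by
    have := Real.rpow_le_rpow hx0.le hx.2.le hs0.le
    rwa [hδ, ← Real.rpow_mul (by positivity), one_div_mul_cancel hs0.ne', Real.rpow_one] at this
  calc _ ≤ x ^ s * A := h2
    _ ≤ c / (A + 1) * A := by gcongr
    _ ≤ c := by rw [div_mul_eq_mul_div, div_le_iff₀ (by positivity)]; nlinarith

theorem limitInterference_rpow_pos (hs : 1 < s) {e : ℕ → ℝ} (he : ∀ i, 0 < e i)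
    (hgrow : ∃ c : ℝ, 0 < c ∧ ∀ᶠ n : ℕ in atTop, c * n ≤ arrival n e) :
    0 < limitInterference (fun a => a ^ (-s)) e := by
  have hA := arrival_pos he 0
  have hpos : ∀ i, 0 < (arrival (i + 2) e / arrival 1 e) ^ (-s) := fun i =>
    Real.rpow_pos_of_pos (one_pos.trans (one_lt_arrival_ratio he i)) _
  have hsum : Summable fun i : ℕ => (arrival (i + 2) e / arrival 1 e) ^ (-s) := by
    have h1 := (summable_nat_add_iff 2).2 (summable_arrival_rpow hgrow hs)
    refine (h1.mul_right (arrival 1 e ^ (-s))⁻¹).congr fun i => ?_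
    rw [Real.div_rpow (arrival_pos he _).le hA.le, div_eq_mul_inv]
  exact hsum.tsum_pos (fun i => (hpos i).le) 0 (hpos 0)

end PowerRatio

/-! ### Domination of the rate -/

theorem lintegral_expLaw_rpow_lt_top {p : ℝ} (hp : -1 < p) :
    ∫⁻ x, ENNReal.ofReal (x ^ p) ∂expLaw < ⊤ := by
  rw [lintegral_expLaw (by fun_prop)]
  have h := Real.GammaIntegral_convergent (s := p + 1) (by linarith)
  simp only [add_sub_cancel_right] at h
  refine lt_of_le_of_lt (le_of_eq ?_) h.lintegral_lt_top
  refine lintegral_congr fun x => ?_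
  rw [← ENNReal.ofReal_mul (Real.exp_pos _).le]

/-- Independence splits the integral into the Gamma integrals at `1/2` and `3/2`. The square root
matters: `1 / e 0` itself is not integrable. -/
theorem lintegral_waiting_sqrt_ratio_lt_top :
    ∫⁻ e, ENNReal.ofReal ((e 0) ^ (-(1/2) : ℝ) * (e 1) ^ (1/2 : ℝ)) ∂waiting < ⊤ := by
  have h1 : (fun e : ℕ → ℝ => ENNReal.ofReal ((e 0) ^ (-(1/2) : ℝ) * (e 1) ^ (1/2 : ℝ)))
      =ᵐ[waiting] fun e => (fun z : ℝ × ℝ => ENNReal.ofReal (z.1 ^ (-(1/2) : ℝ)) *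
        ENNReal.ofReal (z.2 ^ (1/2 : ℝ))) (e 0, e 1) := by
    filter_upwards [ae_waiting_pos] with e he
    rw [ENNReal.ofReal_mul (Real.rpow_nonneg (he 0).le _)]
  rw [lintegral_congr_ae h1, ← lintegral_map (f := fun z : ℝ × ℝ =>
    ENNReal.ofReal (z.1 ^ (-(1/2) : ℝ)) * ENNReal.ofReal (z.2 ^ (1/2 : ℝ))) (by fun_prop)
      (by fun_prop), waiting,
    Measure.infinitePi_map_eval_prod (P := fun _ : ℕ => expLaw) zero_ne_one,
    lintegral_prod_mul (f := fun x : ℝ => ENNReal.ofReal (x ^ (-(1/2) : ℝ)))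
      (g := fun x : ℝ => ENNReal.ofReal (x ^ (1/2 : ℝ))) (by fun_prop) (by fun_prop)]
  exact ENNReal.mul_lt_top (lintegral_expLaw_rpow_lt_top (by norm_num))
    (lintegral_expLaw_rpow_lt_top (by norm_num))

theorem log_one_add_le_sqrt {x : ℝ} (hx : 0 ≤ x) : Real.log (1 + x) ≤ 2 * x ^ (1/2 : ℝ) := by
  rw [← Real.sqrt_eq_rpow]
  have hs := Real.sqrt_nonneg x
  have h1 : 1 + x ≤ (1 + √x) ^ 2 := by nlinarith [Real.sq_sqrt hx]
  calc Real.log (1 + x) ≤ Real.log ((1 + √x) ^ 2) := Real.log_le_log (by linarith) h1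
    _ = 2 * Real.log (1 + √x) := by rw [Real.log_pow]; norm_num
    _ ≤ 2 * √x := by
        have := Real.log_le_sub_one_of_pos (by linarith : 0 < 1 + √x)
        linarith

/-- A bound free of `Λ`. If the second arrival is near the origin, its power is part of the
interference and is comparable with the first by `hgrowth`. Otherwise `Λ` is at most `A_2 / v₁`, and
`hbound` against the noise alone suffices. -/
theorem arrivalSinr_le_rpow_ratio {G : ℝ → ℝ} {κ C v₁ W Λ : ℝ} (hC : 0 < C) (hκ : 0 < κ)
    (hv₁ : 0 < v₁) (hW : 0 < W) (hΛ : 0 < Λ) (h0 : ∀ v, 0 ≤ G v) (h1 : ∀ v, 1 ≤ v → G v = 0)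
    (hgrowth : ∀ v w : ℝ, 0 < v → v ≤ w → w ≤ v₁ → G v ≤ C * (w / v) ^ κ * G w)
    (hbound : ∀ v : ℝ, 0 < v → G v ≤ C * v ^ (-κ)) {e : ℕ → ℝ} (he : ∀ i, 0 < e i)
    (hgrow : ∃ c : ℝ, 0 < c ∧ ∀ᶠ n : ℕ in atTop, c * n ≤ arrival n e) :
    arrivalSinr G W Λ e ≤ (C + C * v₁ ^ (-κ) / W) * (arrival 2 e / arrival 1 e) ^ κ := by
  have hA1 := arrival_pos he 0
  have hA2 := arrival_pos he 1
  have hx := one_lt_arrival_ratio he 0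
  simp only [zero_add] at hx hA1
  have hI0 : 0 ≤ arrivalInterference G Λ e := tsum_nonneg fun _ => h0 _
  have hsum : Summable fun i => G (arrival (i + 2) e / Λ) := by
    obtain ⟨N, hN⟩ := eventually_atTop.1 ((tendsto_arrival hgrow).eventually_ge_atTop Λ)
    refine summable_of_ne_finset_zero (s := Finset.range N) fun i hi => h1 _ ?_
    rw [one_le_div hΛ]
    exact hN _ (by have := Finset.mem_range.not.1 hi; omega)
  have hI2 : G (arrival 2 e / Λ) ≤ arrivalInterference G Λ e :=
    hsum.le_tsum 0 fun _ _ => h0 _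
  have hρ : 0 < (arrival 2 e / arrival 1 e) ^ κ := by positivity
  have hV : 0 < v₁ ^ (-κ) := by positivity
  unfold arrivalSinr
  refine div_le_of_le_mul₀ (by linarith) (by positivity) ?_
  rcases le_or_gt (arrival 2 e / Λ) v₁ with h | h
  · have h2 := hgrowth (arrival 1 e / Λ) (arrival 2 e / Λ) (by positivity)
      (by gcongr; exact ((one_lt_div hA1).1 hx).le) h
    rw [div_div_div_cancel_right₀ hΛ.ne'] at h2
    calc G (arrival 1 e / Λ) ≤ C * (arrival 2 e / arrival 1 e) ^ κ * G (arrival 2 e / Λ) := h2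
      _ ≤ C * (arrival 2 e / arrival 1 e) ^ κ * (arrivalInterference G Λ e + W) := by
          gcongr; linarith
      _ ≤ _ := by
          gcongr
          exact le_add_of_nonneg_right (by positivity)
  · have h2 := hbound (arrival 1 e / Λ) (by positivity)
    have h3 : (arrival 1 e / Λ) ^ (-κ) ≤ v₁ ^ (-κ) * (arrival 2 e / arrival 1 e) ^ κ := by
      have h4 : (arrival 1 e / Λ) ^ (-κ) = (Λ / arrival 1 e) ^ κ := by
        rw [Real.rpow_neg (by positivity), ← Real.inv_rpow (by positivity), inv_div]
      rw [h4, Real.rpow_neg hv₁.le, ← Real.inv_rpow hv₁.le, ← Real.mul_rpow (by positivity)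
        (by positivity)]
      refine Real.rpow_le_rpow (by positivity) ?_ hκ.le
      rw [lt_div_iff₀ hΛ] at h
      rw [← mul_div_assoc]
      refine div_le_div_of_nonneg_right ?_ hA1.le
      rw [inv_mul_eq_div, le_div_iff₀ hv₁]
      linarith
    calc G (arrival 1 e / Λ) ≤ C * (v₁ ^ (-κ) * (arrival 2 e / arrival 1 e) ^ κ) :=
          h2.trans (by gcongr)
      _ = C * v₁ ^ (-κ) / W * (arrival 2 e / arrival 1 e) ^ κ * W := by field_simp
      _ ≤ (C + C * v₁ ^ (-κ) / W) * (arrival 2 e / arrival 1 e) ^ κ *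
          (arrivalInterference G Λ e + W) := by
          gcongr
          · linarith
          · linarith

/-- The logarithm turns the exponent `κ` into a factor, and `A_2 / A_1 = 1 + e 1 / e 0`; hence an
integrable bound whatever the size of `κ`. -/
theorem log_one_add_rpow_ratio_le {K κ : ℝ} (hK : 0 < K) (hκ : 0 < κ) {e : ℕ → ℝ}
    (he : ∀ i, 0 < e i) :
    Real.log (1 + K * (arrival 2 e / arrival 1 e) ^ κ) ≤
      Real.log (1 + K) + κ * 2 * ((e 0) ^ (-(1/2) : ℝ) * (e 1) ^ (1/2 : ℝ)) := by
  have h0 := he 0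
  have h1 := he 1
  have hx : arrival 2 e / arrival 1 e = 1 + e 1 / e 0 := by
    simp only [arrival, Finset.sum_range_succ, Finset.sum_range_zero, zero_add]
    field_simp
  have hr : 0 < e 1 / e 0 := by positivity
  have hρ : 1 ≤ (1 + e 1 / e 0) ^ κ := Real.one_le_rpow (by linarith) hκ.le
  rw [hx]
  calc Real.log (1 + K * (1 + e 1 / e 0) ^ κ) ≤ Real.log ((1 + K) * (1 + e 1 / e 0) ^ κ) :=
        Real.log_le_log (by positivity) (by linarith)
    _ = Real.log (1 + K) + κ * Real.log (1 + e 1 / e 0) := by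
        rw [Real.log_mul (by positivity) (by positivity), Real.log_rpow (by positivity)]
    _ ≤ Real.log (1 + K) + κ * (2 * (e 1 / e 0) ^ (1/2 : ℝ)) := by
        gcongr
        exact log_one_add_le_sqrt hr.le
    _ = _ := by
        rw [Real.div_rpow h1.le h0.le, Real.rpow_neg h0.le]
        ring

/-! ### Positive finite limits for tail index strictly between `-1` and `0`. -/

namespace Pathloss

variable {d : ℕ} (L : Pathloss d) {F : Measure ℝ} [IsProbabilityMeasure F]

/-- The limit is the probability of `Y ≤ y⁻¹`. As `Y` has no atom at `y⁻¹`, the coverage indicators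
converge almost surely. -/
theorem exists_tendsto_coverage_of_regularlyVarying (hF : F (Set.Iio 0) = 0) {α : ℝ} (hα : 0 < α)
    (hα1 : α < 1) (h : RegularlyVarying (tail (L.powerLaw F)) (-α)) {W : ℝ} (hW : 0 < W) {y : ℝ}
    (hy : 0 < y) : ∃ p : ℝ, p ≠ 0 ∧ Tendsto (L.coverage F W y) atTop (𝓝 p) := by
  have hs : 1 < 1 / α := by rw [lt_div_iff₀ hα]; linarith
  set Y := limitInterference fun a => a ^ (-(1 / α)) with hY
  have hYm : Measurable Y := measurable_limitInterference (by fun_prop)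
  have hlim := L.tendsto_waitingSinr_inv hα.le hα1 h
    (fun a ha => h.tendsto_tailQuantile_ratio hα (by linarith)) W
  refine ⟨waiting.real {e | Y e ≤ y⁻¹}, ?_, L.tendsto_coverage_of_ae hF hW y
    (measurableSet_le hYm measurable_const) ?_⟩
  · rw [measureReal_def]
    exact ENNReal.toReal_ne_zero.2
      ⟨waiting_limitInterference_rpow_le_ne_zero hs (inv_pos.2 hy), measure_ne_top _ _⟩
  filter_upwards [hlim, ae_waiting_pos, ae_limitInterference_rpow_ne hs y⁻¹] with e he hpos hne
  have hinv : ∀ z : ℝ, 0 < z → (y ≤ z ↔ z⁻¹ ≤ y⁻¹) := fun z hz => (inv_le_inv₀ hz hy).symm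
  rcases lt_or_gt_of_ne hne with hlt | hgt
  · filter_upwards [he.eventually (gt_mem_nhds hlt), L.eventually_waitingSinr_pos h.1 hW hpos]
      with lam h1 h2
    exact iff_of_true ((hinv _ h2).2 h1.le) hlt.le
  · filter_upwards [he.eventually (lt_mem_nhds hgt), L.eventually_waitingSinr_pos h.1 hW hpos]
      with lam h1 h2
    exact iff_of_false (fun h3 => not_le.2 h1 ((hinv _ h2).1 h3)) (not_le.2 hgt)

/-- Dominated convergence with the density-free majorant `D`, which also bounds the limit; the limit
is nonzero because `1 / Y` is almost surely positive. -/
theorem exists_tendsto_rate_of_regularlyVarying (hF : F (Set.Iio 0) = 0) {α : ℝ} (hα : 0 < α)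
    (hα1 : α < 1) (h : RegularlyVarying (tail (L.powerLaw F)) (-α)) {W : ℝ} (hW : 0 < W) :
    ∃ c : ℝ≥0∞, c ≠ 0 ∧ c ≠ ⊤ ∧ Tendsto (L.rate F W) atTop (𝓝 c) := by
  have hs : 1 < 1 / α := by rw [lt_div_iff₀ hα]; linarith
  set Y := limitInterference fun a => a ^ (-(1 / α)) with hY
  have hYm : Measurable Y := measurable_limitInterference (by fun_prop)
  have hlim := L.tendsto_waitingSinr_inv hα.le hα1 h
    (fun a ha => h.tendsto_tailQuantile_ratio hα (by linarith)) W
  obtain ⟨κ, C, v₁, hκ, hC, hv₁, hgrowth, hbound⟩ := h.exists_tailQuantile_growth hα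
  set K : ℝ := C + C * v₁ ^ (-κ) / W with hK
  have hK0 : 0 < K := by positivity
  set D : (ℕ → ℝ) → ℝ≥0∞ := fun e => ENNReal.ofReal (Real.log (1 + K)) +
    ENNReal.ofReal (κ * 2) * ENNReal.ofReal ((e 0) ^ (-(1/2) : ℝ) * (e 1) ^ (1/2 : ℝ)) with hD
  have hDfin : ∫⁻ e, D e ∂waiting ≠ ⊤ := by
    rw [hD, lintegral_add_left measurable_const, lintegral_const,
      lintegral_const_mul' _ _ ENNReal.ofReal_ne_top]
    exact ENNReal.add_ne_top.2 ⟨by simp, (ENNReal.mul_lt_top ENNReal.ofReal_lt_top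
      lintegral_waiting_sqrt_ratio_lt_top).ne⟩
  have hle : ∀ lam : ℝ≥0, 0 < lam →
      ∀ᵐ e ∂waiting, ENNReal.ofReal (Real.log (1 + L.waitingSinr F W lam e)) ≤ D e := by
    intro lam hlam
    have hΛ : 0 < L.meanCount lam := by
      have := mul_pos hlam L.volume_domain_toNNReal_pos
      exact_mod_cast this
    filter_upwards [ae_waiting_pos, ae_waiting_linear_growth] with e he hgrow
    have h0 := he 0
    have h1 := he 1
    rw [hD]
    simp only
    rw [← ENNReal.ofReal_mul (by positivity), ← ENNReal.ofReal_add
      (Real.log_nonneg (by linarith)) (by positivity)]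
    refine ENNReal.ofReal_le_ofReal (le_trans (Real.log_le_log ?_ ?_)
      (log_one_add_rpow_ratio_le hK0 hκ he))
    · have := L.waitingSinr_nonneg F hW lam e
      linarith
    · have := arrivalSinr_le_rpow_ratio hC hκ hv₁ hW hΛ (tailQuantile_nonneg _)
        (fun v => tailQuantile_eq_zero (μ := L.powerLaw F)) hgrowth hbound he hgrow
      simpa [waitingSinr] using this
  have hpt : ∀ᵐ e ∂waiting, Tendsto
      (fun lam => ENNReal.ofReal (Real.log (1 + L.waitingSinr F W lam e))) atTop
      (𝓝 (ENNReal.ofReal (Real.log (1 + (Y e)⁻¹)))) := by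
    filter_upwards [hlim, ae_waiting_pos, ae_waiting_linear_growth] with e he hpos hgrow
    have hY0 : 0 < Y e := limitInterference_rpow_pos hs hpos hgrow
    have h1 := he.inv₀ hY0.ne'
    simp only [inv_inv] at h1
    have h2 : (1 + (Y e)⁻¹) ≠ 0 := by positivity
    exact ENNReal.tendsto_ofReal ((h1.const_add 1).log h2)
  have htend : Tendsto (L.rate F W) atTop
      (𝓝 (∫⁻ e, ENNReal.ofReal (Real.log (1 + (Y e)⁻¹)) ∂waiting)) := by
    have := tendsto_lintegral_filter_of_dominated_convergence (μ := waiting)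
      (F := fun lam e => ENNReal.ofReal (Real.log (1 + L.waitingSinr F W lam e))) D
      (l := atTop) (Eventually.of_forall fun lam => by fun_prop)
      (by filter_upwards [eventually_gt_atTop 0] with lam hlam using hle lam hlam) hDfin hpt
    refine this.congr' ?_
    filter_upwards [eventually_gt_atTop 0] with lam hlam
    rw [L.rate_eq_waiting hF hW hlam]
  refine ⟨_, ?_, ?_, htend⟩
  · intro h0
    rw [lintegral_eq_zero_iff (by fun_prop)] at h0
    obtain ⟨e, ⟨h1, hpos⟩, hgrow⟩ :=
      ((h0.and ae_waiting_pos).and ae_waiting_linear_growth).exists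
    have hY0 : 0 < Y e := limitInterference_rpow_pos hs hpos hgrow
    have h2 : Real.log (1 + (Y e)⁻¹) ≤ 0 := ENNReal.ofReal_eq_zero.1 h1
    have h3 : 0 < Real.log (1 + (Y e)⁻¹) := Real.log_pos (by
      have := inv_pos.2 hY0
      linarith)
    linarith
  · refine ne_top_of_le_ne_top hDfin (le_of_tendsto htend ?_)
    filter_upwards [eventually_gt_atTop 0] with lam hlam
    rw [L.rate_eq_waiting hF hW hlam]
    exact lintegral_mono_ae (hle lam hlam)

end Pathloss

/-! ### Tails with finite mean -/

/-- On dyadic blocks the length doubles while the function shrinks by `q < 1/2`, so the block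
integrals are dominated by a geometric series of ratio `2 * q`. -/
theorem lintegral_Ioi_lt_top_of_doubling {h : ℝ → ℝ} (hanti : Antitone h) (h0 : ∀ x, 0 ≤ h x)
    {q x₀ : ℝ} (hq0 : 0 ≤ q) (hq : q < 1 / 2) (hx₀ : 0 < x₀)
    (hh : ∀ x, x₀ ≤ x → h (2 * x) ≤ q * h x) :
    ∫⁻ x in Set.Ioi x₀, ENNReal.ofReal (h x) < ⊤ := by
  have hpow : ∀ k : ℕ, h (2 ^ k * x₀) ≤ q ^ k * h x₀ := by
    intro k
    induction k with
    | zero => simp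
    | succ k ih =>
      have h1 : x₀ ≤ 2 ^ k * x₀ := le_mul_of_one_le_left hx₀.le (one_le_pow₀ (by norm_num))
      calc h (2 ^ (k + 1) * x₀) = h (2 * (2 ^ k * x₀)) := by rw [pow_succ]; ring_nf
        _ ≤ q * h (2 ^ k * x₀) := hh _ h1
        _ ≤ q * (q ^ k * h x₀) := by gcongr
        _ = _ := by ring
  set s : ℕ → Set ℝ := fun k => Set.Ico (2 ^ k * x₀) (2 ^ (k + 1) * x₀) with hs
  have hcov : Set.Ioi x₀ ⊆ ⋃ k, s k := by
    intro x hx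
    have hx : x₀ < x := hx
    obtain ⟨k, hk1, hk2⟩ := exists_nat_pow_near (x := x / x₀) (y := 2)
      ((one_le_div hx₀).2 hx.le) one_lt_two
    exact Set.mem_iUnion.2 ⟨k, (le_div_iff₀ hx₀).1 hk1, (div_lt_iff₀ hx₀).1 hk2⟩
  have hterm : ∀ k, ∫⁻ x in s k, ENNReal.ofReal (h x) ≤
      ENNReal.ofReal (x₀ * h x₀ * (2 * q) ^ k) := by
    intro k
    calc ∫⁻ x in s k, ENNReal.ofReal (h x) ≤ ∫⁻ _ in s k, ENNReal.ofReal (q ^ k * h x₀) :=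
          setLIntegral_mono measurable_const fun x hx =>
            ENNReal.ofReal_le_ofReal ((hanti hx.1).trans (hpow k))
      _ = ENNReal.ofReal (q ^ k * h x₀) * ENNReal.ofReal (2 ^ k * x₀) := by
          rw [setLIntegral_const, hs, Real.volume_Ico]
          congr 2
          rw [pow_succ]; ring
      _ = _ := by
          rw [← ENNReal.ofReal_mul (mul_nonneg (by positivity) (h0 _))]
          congr 1
          rw [mul_pow]; ring
  have hsum : Summable fun k : ℕ => x₀ * h x₀ * (2 * q) ^ k :=
    (summable_geometric_of_lt_one (by positivity) (by linarith)).mul_left _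
  calc ∫⁻ x in Set.Ioi x₀, ENNReal.ofReal (h x) ≤ ∫⁻ x in ⋃ k, s k, ENNReal.ofReal (h x) :=
        lintegral_mono_set hcov
    _ ≤ ∑' k, ∫⁻ x in s k, ENNReal.ofReal (h x) := lintegral_iUnion_le _ _
    _ ≤ ∑' k : ℕ, ENNReal.ofReal (x₀ * h x₀ * (2 * q) ^ k) := ENNReal.tsum_le_tsum hterm
    _ < ⊤ := hsum.tsum_ofReal_lt_top

theorem lintegral_ofReal_lt_top_of_tail_le {μ H : Measure ℝ} [IsProbabilityMeasure μ]
    [IsProbabilityMeasure H] (hμ : μ (Set.Iio 0) = 0) {q : ℝ} (hq0 : 0 ≤ q) (hq : q < 1 / 2)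
    (hpos : ∀ x, 0 < x → 0 < tail H x)
    (hH : ∀ᶠ x in atTop, tail H (2 * x) / tail H x ≤ q)
    (hle : ∀ᶠ x in atTop, tail μ x ≤ tail H x) : ∫⁻ x, ENNReal.ofReal x ∂μ < ⊤ := by
  obtain ⟨x₁, hx₁⟩ := eventually_atTop.1 (hH.and hle)
  set x₀ : ℝ := max x₁ 1 with hx₀
  have hx₀0 : 0 < x₀ := lt_max_of_lt_right one_pos
  have hfin := lintegral_Ioi_lt_top_of_doubling (tail_antitone H) (tail_nonneg H) hq0 hq hx₀0
    fun x hx => by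
      have := (hx₁ x ((le_max_left _ _).trans hx)).1
      rwa [div_le_iff₀ (hpos x (hx₀0.trans_le hx))] at this
  have hnn : 0 ≤ᵐ[μ] (id : ℝ → ℝ) := by
    change ∀ᵐ x ∂μ, 0 ≤ x
    rw [ae_iff]
    simpa [Set.Iio] using hμ
  have hlc := lintegral_eq_lintegral_meas_lt μ hnn aemeasurable_id
  simp only [id] at hlc
  rw [hlc]
  have hset : ∀ t, μ {a | t < a} = ENNReal.ofReal (tail μ t) := fun t =>
    (ofReal_measureReal).symm
  simp only [hset]
  rw [← Set.Ioc_union_Ioi_eq_Ioi hx₀0.le,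
    lintegral_union measurableSet_Ioi (Set.Ioc_disjoint_Ioi le_rfl)]
  refine ENNReal.add_lt_top.2 ⟨?_, ?_⟩
  · refine lt_of_le_of_lt (setLIntegral_mono (g := fun _ => 1) measurable_const fun x _ => ?_) ?_
    · exact (ENNReal.ofReal_le_ofReal (tail_le_one μ x)).trans (by simp)
    · simp
  · refine lt_of_le_of_lt (setLIntegral_mono' measurableSet_Ioi fun x hx => ?_) hfin
    exact ENNReal.ofReal_le_ofReal (hx₁ x ((le_max_left _ _).trans (le_of_lt hx))).2

theorem RapidlyVarying.eventually_ratio_le {h : ℝ → ℝ} (hh : RapidlyVarying h) :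
    ∀ᶠ x in atTop, h (2 * x) / h x ≤ 1 / 4 :=
  (hh.2.2.1 2 one_lt_two).eventually (ge_mem_nhds (by norm_num))

/-- Excluding indices in `[-1, 0]` leaves `ρ > 1`, where the doubling ratio tends to `2 ^ (-ρ) <
1/2`. For rapid variation the ratio tends to zero, and a lighter tail is compared with the rapid
one. -/
theorem lintegral_ofReal_lt_top_of_classified {μ : Measure ℝ} [IsProbabilityMeasure μ]
    (hμ : μ (Set.Iio 0) = 0)
    (hnot : ∀ α : ℝ, 0 ≤ α → α ≤ 1 → ¬ RegularlyVarying (tail μ) (-α))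
    (h : ClassifiedTail μ ∨ Integrable id μ) : ∫⁻ x, ENNReal.ofReal x ∂μ < ⊤ := by
  rcases h with (⟨ρ, hρ, h⟩ | h | ⟨H, hH, hrap, ho⟩) | h
  · have hρ1 : 1 < ρ := by
      by_contra hle
      exact hnot ρ hρ (not_lt.1 hle) h
    have h2 : (2:ℝ) ^ (-ρ) < 1 / 2 := by
      rw [one_div, ← Real.rpow_neg_one]
      exact Real.rpow_lt_rpow_of_exponent_lt (by norm_num) (by linarith)
    obtain ⟨q, hq1, hq2⟩ := exists_between h2
    exact lintegral_ofReal_lt_top_of_tail_le hμ ((by positivity : (0:ℝ) ≤ 2 ^ (-ρ)).trans hq1.le)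
      hq2 h.1 ((h.2.2 2 two_pos).eventually (ge_mem_nhds hq1)) (Eventually.of_forall fun _ => le_rfl)
  · exact lintegral_ofReal_lt_top_of_tail_le hμ (by norm_num) (by norm_num) h.1
      h.eventually_ratio_le (Eventually.of_forall fun _ => le_rfl)
  · refine lintegral_ofReal_lt_top_of_tail_le hμ (by norm_num) (by norm_num) hrap.1
      hrap.eventually_ratio_le ?_
    filter_upwards [ho.bound one_pos] with x hx
    rwa [Real.norm_of_nonneg (tail_nonneg _ _), Real.norm_of_nonneg (tail_nonneg _ _),
      one_mul] at hx
  · exact h.lintegral_lt_top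

/-! ### The mean signal quality of many independent powers of finite mean -/

theorem sinrOf_nonneg {W : ℝ} (hW : 0 < W) {n : ℕ} {p : Fin n → ℝ} (hp : ∀ i, 0 ≤ p i) :
    0 ≤ sinrOf W p :=
  Real.iSup_nonneg fun i => div_nonneg (hp i)
    (add_nonneg (Finset.sum_nonneg fun j _ => hp j) hW.le)

/-- A quality above `ε` has one of two causes. Either the interference is below `b`, which costs a
factor `exp (b - interference) ≥ 1` on the bound `p i / W`; or it is at least `b`, and then `p i > ε
* b` and the quality is at most `p i / b`. The maximum is bounded by the sum. -/
theorem sinrOf_le {W ε b : ℝ} (hW : 0 < W) (hε : 0 ≤ ε) (hb : 0 < b) {n : ℕ} {p : Fin n → ℝ}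
    (hp : ∀ i, 0 ≤ p i) :
    sinrOf W p ≤ ε + ∑ i, (Real.exp b / W * (p i * Real.exp (-∑ j ∈ Finset.univ.erase i, p j)) +
      b⁻¹ * (Set.Ioi (ε * b)).indicator id (p i)) := by
  have hind : ∀ x : ℝ, 0 ≤ x → 0 ≤ (Set.Ioi (ε * b)).indicator id x := fun x hx =>
    Set.indicator_apply_nonneg fun _ => hx
  have hterm : ∀ i, 0 ≤ Real.exp b / W * (p i * Real.exp (-∑ j ∈ Finset.univ.erase i, p j)) +
      b⁻¹ * (Set.Ioi (ε * b)).indicator id (p i) := by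
    intro i
    have h1 := hp i
    have h2 := hind _ h1
    positivity
  refine Real.iSup_le (fun i => ?_) (add_nonneg hε (Finset.sum_nonneg fun i _ => hterm i))
  set T := ∑ j ∈ Finset.univ.erase i, p j with hT
  have hT0 : 0 ≤ T := Finset.sum_nonneg fun j _ => hp j
  have hi := hp i
  rcases le_or_gt (p i / (T + W)) ε with h | h
  · exact h.trans (le_add_of_nonneg_right (Finset.sum_nonneg fun i _ => hterm i))
  refine le_trans ?_ (le_add_of_nonneg_left hε)
  refine le_trans ?_ (Finset.single_le_sum (fun j _ => hterm j) (Finset.mem_univ i))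
  rw [← hT]
  rcases lt_or_ge T b with hTb | hTb
  · refine le_trans ?_ (le_add_of_nonneg_right (mul_nonneg (inv_nonneg.2 hb.le) (hind _ hi)))
    have h1 : 1 ≤ Real.exp b * Real.exp (-T) := by
      rw [← Real.exp_add]
      exact Real.one_le_exp (by linarith)
    calc p i / (T + W) ≤ p i / W := div_le_div_of_nonneg_left hi hW (by linarith)
      _ = 1 * (p i / W) := by ring
      _ ≤ Real.exp b * Real.exp (-T) * (p i / W) := by gcongr
      _ = _ := by ring
  · refine le_trans ?_ (le_add_of_nonneg_left (by positivity))
    have h1 : p i ∈ Set.Ioi (ε * b) := by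
      rw [lt_div_iff₀ (by linarith)] at h
      refine lt_of_le_of_lt ?_ h
      gcongr
      linarith
    rw [Set.indicator_of_mem h1, id, inv_mul_eq_div]
    exact div_le_div_of_nonneg_left hi hb (by linarith)

section FiniteMean

variable {μ : Measure ℝ} [IsProbabilityMeasure μ]

theorem ae_pi_nonneg (hμ : μ (Set.Iio 0) = 0) (n : ℕ) :
    ∀ᵐ p ∂(Measure.pi fun _ : Fin n => μ), ∀ i, 0 ≤ p i := by
  rw [ae_all_iff]
  intro i
  have : ∀ᵐ x ∂μ, 0 ≤ x := by
    rw [ae_iff]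
    simpa [Set.Iio] using hμ
  exact (measurePreserving_eval (fun _ : Fin n => μ) i).quasiMeasurePreserving.ae this

theorem lintegral_pi_eval (n : ℕ) (i : Fin n) {f : ℝ → ℝ≥0∞} (hf : Measurable f) :
    ∫⁻ p, f (p i) ∂(Measure.pi fun _ : Fin n => μ) = ∫⁻ x, f x ∂μ :=
  (measurePreserving_eval (fun _ : Fin n => μ) i).lintegral_comp hf

theorem lintegral_pi_mul_prod_erase {n : ℕ} (i : Fin (n + 1)) {f g : ℝ → ℝ≥0∞}
    (hf : Measurable f) (hg : Measurable g) :
    ∫⁻ p, f (p i) * ∏ j ∈ Finset.univ.erase i, g (p j) ∂(Measure.pi fun _ : Fin (n + 1) => μ) =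
      (∫⁻ x, f x ∂μ) * (∫⁻ x, g x ∂μ) ^ n := by
  classical
  set X : Fin (n + 1) → ℝ → ℝ≥0∞ := fun j => if j = i then f else g with hX
  have hXm : ∀ j, Measurable (X j) := fun j => by
    simp only [hX]; split_ifs <;> assumption
  have hXg : ∀ j ∈ Finset.univ.erase i, X j = g := fun j hj => by
    simp [hX, Finset.ne_of_mem_erase hj]
  have hXi : X i = f := by simp [hX]
  have hind : iIndepFun (fun j (p : Fin (n + 1) → ℝ) => X j (p j))
      (Measure.pi fun _ : Fin (n + 1) => μ) := iIndepFun_pi fun j => (hXm j).aemeasurable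
  have h := lintegral_prod_eq_prod_lintegral_of_indepFun Finset.univ _ hind
    fun j => (hXm j).comp (measurable_pi_apply j)
  have h1 : ∀ p : Fin (n + 1) → ℝ, ∏ j, X j (p j) =
      f (p i) * ∏ j ∈ Finset.univ.erase i, g (p j) := by
    intro p
    rw [← Finset.mul_prod_erase _ _ (Finset.mem_univ i), hXi]
    congr 1
    exact Finset.prod_congr rfl fun j hj => by rw [hXg j hj]
  have h2 : ∀ j, ∫⁻ p, X j (p j) ∂(Measure.pi fun _ : Fin (n + 1) => μ) = ∫⁻ x, X j x ∂μ :=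
    fun j => lintegral_pi_eval _ j (hXm j)
  simp only [h1, h2] at h
  rw [h, ← Finset.mul_prod_erase _ _ (Finset.mem_univ i), hXi]
  congr 1
  rw [Finset.prod_congr rfl fun j hj => by rw [hXg j hj], Finset.prod_const,
    Finset.card_erase_of_mem (Finset.mem_univ i)]
  simp

theorem lintegral_sinrOf_le (hμ : μ (Set.Iio 0) = 0) {W ε b : ℝ} (hW : 0 < W) (hε : 0 ≤ ε)
    (hb : 0 < b) (n : ℕ) :
    ∫⁻ p, ENNReal.ofReal (sinrOf W p) ∂(Measure.pi fun _ : Fin (n + 1) => μ) ≤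
      ENNReal.ofReal ε + (n + 1 : ℕ) * (ENNReal.ofReal (Real.exp b / W) *
        ((∫⁻ x, ENNReal.ofReal x ∂μ) * (∫⁻ x, ENNReal.ofReal (Real.exp (-x)) ∂μ) ^ n) +
        ENNReal.ofReal b⁻¹ * ∫⁻ x in Set.Ioi (ε * b), ENNReal.ofReal x ∂μ) := by
  have hpt : ∀ᵐ p ∂(Measure.pi fun _ : Fin (n + 1) => μ), ENNReal.ofReal (sinrOf W p) ≤
      ENNReal.ofReal ε + ∑ i, (ENNReal.ofReal (Real.exp b / W) * (ENNReal.ofReal (p i) *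
        ∏ j ∈ Finset.univ.erase i, ENNReal.ofReal (Real.exp (-(p j)))) +
        ENNReal.ofReal b⁻¹ * (Set.Ioi (ε * b)).indicator (fun x => ENNReal.ofReal x) (p i)) := by
    filter_upwards [ae_pi_nonneg hμ (n + 1)] with p hp
    refine (ENNReal.ofReal_le_ofReal (sinrOf_le hW hε hb hp)).trans ?_
    have hind : ∀ x : ℝ, 0 ≤ x → 0 ≤ (Set.Ioi (ε * b)).indicator id x := fun x hx =>
      Set.indicator_apply_nonneg fun _ => hx
    refine ENNReal.ofReal_add_le.trans (add_le_add_right ?_ _)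
    refine (ENNReal.ofReal_sum_of_nonneg fun i _ => ?_).trans_le ?_
    · have h1 := hp i
      have h2 := hind _ h1
      positivity
    refine Finset.sum_le_sum fun i _ => ENNReal.ofReal_add_le.trans (add_le_add ?_ ?_)
    · rw [ENNReal.ofReal_mul (by positivity), ENNReal.ofReal_mul (hp i),
        ← ENNReal.ofReal_prod_of_nonneg fun j _ => (Real.exp_pos _).le, ← Real.exp_sum,
        Finset.sum_neg_distrib]
    · rw [ENNReal.ofReal_mul (by positivity)]
      refine mul_le_mul_right (le_of_eq ?_) _
      by_cases h : p i ∈ Set.Ioi (ε * b)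
      · rw [Set.indicator_of_mem h, Set.indicator_of_mem h, id]
      · rw [Set.indicator_of_notMem h, Set.indicator_of_notMem h, ENNReal.ofReal_zero]
  have hindm : Measurable ((Set.Ioi (ε * b)).indicator fun x => ENNReal.ofReal x) :=
    ENNReal.measurable_ofReal.indicator measurableSet_Ioi
  refine (lintegral_mono_ae hpt).trans (le_of_eq ?_)
  rw [lintegral_add_left measurable_const, lintegral_const, measure_univ, mul_one,
    lintegral_finsetSum _ fun i _ => by fun_prop]
  congr 1
  rw [Finset.sum_congr rfl (g := fun _ => _) fun i _ => ?_, Finset.sum_const, Finset.card_univ,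
    Fintype.card_fin, nsmul_eq_mul]
  rw [lintegral_add_left (by fun_prop), lintegral_const_mul _ (by fun_prop),
    lintegral_const_mul _ (by fun_prop),
    lintegral_pi_mul_prod_erase i ENNReal.measurable_ofReal measurable_ofReal_exp_neg,
    lintegral_pi_eval _ i hindm, lintegral_indicator measurableSet_Ioi]

theorem lintegral_exp_neg_lt_one (hμ : μ (Set.Iio 0) = 0) (hpos : μ (Set.Ioi 0) ≠ 0) :
    ∫⁻ x, ENNReal.ofReal (Real.exp (-x)) ∂μ < 1 := by
  have hnn : ∀ᵐ x ∂μ, 0 ≤ x := by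
    rw [ae_iff]
    simpa [Set.Iio] using hμ
  have hsum : ∫⁻ x, ENNReal.ofReal (Real.exp (-x)) ∂μ +
      ∫⁻ x, ENNReal.ofReal (1 - Real.exp (-x)) ∂μ = 1 := by
    rw [← lintegral_add_left (by fun_prop)]
    have : (fun x => ENNReal.ofReal (Real.exp (-x)) + ENNReal.ofReal (1 - Real.exp (-x)))
        =ᵐ[μ] fun _ => 1 := by
      filter_upwards [hnn] with x hx
      have : Real.exp (-x) ≤ 1 := Real.exp_le_one_iff.2 (by linarith)
      rw [← ENNReal.ofReal_add (Real.exp_pos _).le (by linarith)]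
      simp
    rw [lintegral_congr_ae this]
    simp
  have hne : ∫⁻ x, ENNReal.ofReal (1 - Real.exp (-x)) ∂μ ≠ 0 := by
    intro h
    rw [lintegral_eq_zero_iff (by fun_prop)] at h
    refine hpos (measure_mono_null (fun x hx => ?_) h)
    have hx : 0 < x := hx
    have : Real.exp (-x) < 1 := by
      rw [← Real.exp_zero]
      exact Real.exp_lt_exp.2 (by linarith)
    intro h0
    have : 1 - Real.exp (-x) ≤ 0 := ENNReal.ofReal_eq_zero.1 h0
    linarith
  have hfin : ∫⁻ x, ENNReal.ofReal (Real.exp (-x)) ∂μ ≠ ⊤ :=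
    ne_top_of_le_ne_top ENNReal.one_ne_top (hsum ▸ le_self_add)
  calc _ < _ := ENNReal.lt_add_right hfin hne
    _ = 1 := hsum

theorem tendsto_setLIntegral_Ioi_ofReal (hm : ∫⁻ x, ENNReal.ofReal x ∂μ < ⊤) :
    Tendsto (fun t => ∫⁻ x in Set.Ioi t, ENNReal.ofReal x ∂μ) atTop (𝓝 0) := by
  simp_rw [← lintegral_indicator measurableSet_Ioi]
  have := tendsto_lintegral_filter_of_dominated_convergence (μ := μ) (l := atTop)
    (F := fun (t : ℝ) x => (Set.Ioi t).indicator (fun x => ENNReal.ofReal x) x) (f := fun _ => 0)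
    (fun x => ENNReal.ofReal x)
    (Eventually.of_forall fun t => ENNReal.measurable_ofReal.indicator measurableSet_Ioi)
    (Eventually.of_forall fun t => ae_of_all _ fun x => Set.indicator_le_self _ _ _) hm.ne
    (ae_of_all _ fun x => tendsto_const_nhds.congr' (by
      filter_upwards [eventually_ge_atTop x] with t ht
      rw [Set.indicator_of_notMem (s := Set.Ioi t) (by simpa using ht)]))
  simpa using this

/-- The threshold `b` grows linearly in the number of nodes. Interference below it is exponentially
unlikely, by the Laplace transform, and powers of that order contribute only a vanishing tail of the
finite mean. -/
theorem tendsto_lintegral_sinrOf (hμ : μ (Set.Iio 0) = 0) (hpos : μ (Set.Ioi 0) ≠ 0)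
    (hm : ∫⁻ x, ENNReal.ofReal x ∂μ < ⊤) {W : ℝ} (hW : 0 < W) :
    Tendsto (fun n : ℕ => ∫⁻ p, ENNReal.ofReal (sinrOf W p) ∂(Measure.pi fun _ : Fin n => μ))
      atTop (𝓝 0) := by
  rw [← tendsto_add_atTop_iff_nat 1]
  have hφ1 := lintegral_exp_neg_lt_one hμ hpos
  set φ := ∫⁻ x, ENNReal.ofReal (Real.exp (-x)) ∂μ with hφ
  set m := ∫⁻ x, ENNReal.ofReal x ∂μ with hmdef
  have hφr : φ.toReal < 1 := by
    rw [← ENNReal.toReal_one]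
    exact (ENNReal.toReal_lt_toReal (hφ1.trans ENNReal.one_lt_top).ne ENNReal.one_ne_top).2 hφ1
  -- Possible because `φ`, the Laplace transform of the power at one, is strictly below one.
  obtain ⟨η, hη1, hη0⟩ : ∃ η : ℝ, Real.exp η * φ.toReal < 1 ∧ 0 < η := by
    have hc : ContinuousAt (fun η : ℝ => Real.exp η * φ.toReal) 0 := by fun_prop
    have := (hc.eventually (gt_mem_nhds (by simpa using hφr))).filter_mono
      (nhdsWithin_le_nhds (s := Set.Ioi 0))
    exact (this.and self_mem_nhdsWithin).exists
  set ρ := Real.exp η * φ.toReal with hρ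
  have hρ0 : 0 ≤ ρ := by positivity
  refine ENNReal.tendsto_nhds_zero.2 fun ε' hε' => ?_
  obtain ⟨ε, hε0, hε⟩ : ∃ ε : ℝ, 0 < ε ∧ ENNReal.ofReal ε < ε' := by
    obtain ⟨r, hr0, hr⟩ := ENNReal.lt_iff_exists_nnreal_btwn.1 hε'
    exact ⟨r, by exact_mod_cast hr0, by simpa using hr⟩
  have hbound : ∀ n : ℕ, ∫⁻ p, ENNReal.ofReal (sinrOf W p) ∂(Measure.pi fun _ : Fin (n + 1) => μ) ≤
      ENNReal.ofReal ε + (ENNReal.ofReal (Real.exp η / W * ((n + 1 : ℕ) * ρ ^ n)) * m +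
        ENNReal.ofReal η⁻¹ * ∫⁻ x in Set.Ioi (ε * (η * (n + 1 : ℕ))), ENNReal.ofReal x ∂μ) := by
    intro n
    have hn : (0:ℝ) < (n + 1 : ℕ) := by exact_mod_cast n.succ_pos
    -- With this `b`, the factor `exp b` combines with `φ ^ n` into `ρ ^ n`, and `(n + 1) / b`
    -- reduces to `η⁻¹`.
    refine (lintegral_sinrOf_le hμ hW hε0.le (b := η * (n + 1 : ℕ)) (by positivity) n).trans
      (le_of_eq ?_)
    rw [← hφ, ← hmdef]
    congr 1
    rw [mul_add]
    congr 1
    · rw [← ENNReal.ofReal_toReal (hφ1.trans ENNReal.one_lt_top).ne,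
        ← ENNReal.ofReal_pow ENNReal.toReal_nonneg, ← ENNReal.ofReal_natCast (n + 1),
        mul_comm m, ← mul_assoc, ← mul_assoc, ← ENNReal.ofReal_mul (by positivity),
        ← ENNReal.ofReal_mul (by positivity)]
      congr 2
      have : Real.exp (η * (n + 1 : ℕ)) = Real.exp η * Real.exp η ^ n := by
        rw [← Real.exp_nat_mul, ← Real.exp_add]
        congr 1
        push_cast; ring
      rw [this, hρ, mul_pow]
      ring
    · rw [← ENNReal.ofReal_natCast (n + 1), ← mul_assoc, ← ENNReal.ofReal_mul (by positivity)]
      congr 2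
      field_simp
  have hlim1 : Tendsto (fun n : ℕ => ENNReal.ofReal (Real.exp η / W * ((n + 1 : ℕ) * ρ ^ n)) * m)
      atTop (𝓝 0) := by
    have h1 : Tendsto (fun n : ℕ => Real.exp η / W * (((n + 1 : ℕ) : ℝ) * ρ ^ n)) atTop (𝓝 0) := by
      have h2 := (tendsto_self_mul_const_pow_of_lt_one hρ0 hη1).add
        (tendsto_pow_atTop_nhds_zero_of_lt_one hρ0 hη1)
      have h3 := h2.const_mul (Real.exp η / W)
      simp only [add_zero, mul_zero] at h3
      refine h3.congr fun n => ?_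
      push_cast; ring
    have := ENNReal.Tendsto.mul_const (ENNReal.tendsto_ofReal h1) (Or.inr hm.ne)
    simpa using this
  have hlim2 : Tendsto (fun n : ℕ => ENNReal.ofReal η⁻¹ *
      ∫⁻ x in Set.Ioi (ε * (η * (n + 1 : ℕ))), ENNReal.ofReal x ∂μ) atTop (𝓝 0) := by
    have h1 : Tendsto (fun n : ℕ => ε * (η * (n + 1 : ℕ))) atTop atTop :=
      (((tendsto_natCast_atTop_atTop.comp (tendsto_add_atTop_nat 1)).const_mul_atTop
        hη0)).const_mul_atTop hε0
    have := ENNReal.Tendsto.const_mul (a := ENNReal.ofReal η⁻¹)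
      ((tendsto_setLIntegral_Ioi_ofReal hm).comp h1) (Or.inr ENNReal.ofReal_ne_top)
    simpa using this
  have hlim := (hlim1.add hlim2).const_add (ENNReal.ofReal ε)
  simp only [add_zero] at hlim
  filter_upwards [hlim.eventually (gt_mem_nhds hε)] with n hn
  exact (hbound n).trans hn.le

theorem lintegral_sinrOf_ne_top (hμ : μ (Set.Iio 0) = 0)
    (hm : ∫⁻ x, ENNReal.ofReal x ∂μ < ⊤) {W : ℝ} (hW : 0 < W) (n : ℕ) :
    ∫⁻ p, ENNReal.ofReal (sinrOf W p) ∂(Measure.pi fun _ : Fin n => μ) ≠ ⊤ := by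
  cases n with
  | zero => simp [sinrOf]
  | succ n =>
    refine ne_top_of_le_ne_top ?_ (lintegral_sinrOf_le hμ hW le_rfl one_pos n)
    have hφ : ∫⁻ x, ENNReal.ofReal (Real.exp (-x)) ∂μ ≠ ⊤ := by
      refine ne_top_of_le_ne_top (b := 1) ENNReal.one_ne_top ?_
      refine (lintegral_mono_ae (g := fun _ => 1) ?_).trans (by simp)
      have hnn : ∀ᵐ x ∂μ, 0 ≤ x := by
        rw [ae_iff]
        simpa [Set.Iio] using hμ
      filter_upwards [hnn] with x hx
      rw [← ENNReal.ofReal_one]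
      exact ENNReal.ofReal_le_ofReal (Real.exp_le_one_iff.2 (by linarith))
    have hτ : ∫⁻ x in Set.Ioi (0 * 1), ENNReal.ofReal x ∂μ ≠ ⊤ :=
      ne_top_of_le_ne_top hm.ne (setLIntegral_le_lintegral _ _)
    exact ENNReal.add_ne_top.2 ⟨ENNReal.ofReal_ne_top, ENNReal.mul_ne_top
      (ENNReal.natCast_ne_top _) (ENNReal.add_ne_top.2 ⟨ENNReal.mul_ne_top ENNReal.ofReal_ne_top
        (ENNReal.mul_ne_top hm.ne (ENNReal.pow_ne_top hφ)),
        ENNReal.mul_ne_top ENNReal.ofReal_ne_top hτ⟩)⟩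

end FiniteMean

/-! ### Poisson mixtures -/

theorem tendsto_poissonMeasure_singleton {c : ℝ≥0} (hc : 0 < c) (n : ℕ) :
    Tendsto (fun lam : ℝ≥0 => poissonMeasure (lam * c) {n}) atTop (𝓝 0) := by
  simp only [poissonMeasure_singleton]
  rw [← ENNReal.ofReal_zero]
  refine ENNReal.tendsto_ofReal ?_
  have h := ((Real.tendsto_pow_mul_exp_neg_atTop_nhds_zero n).comp
    (tendsto_mul_coe_atTop hc)).div_const (n.factorial : ℝ)
  rw [zero_div] at h
  exact h.congr fun lam => by simp only [Function.comp]; ring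

/-- Poisson mass leaves every fixed `n` as the mean grows, so only the tail of `a` matters;
finiteness disposes of the initial terms. -/
theorem tendsto_tsum_poissonMeasure_mul {c : ℝ≥0} (hc : 0 < c) {a : ℕ → ℝ≥0∞}
    (hfin : ∀ n, a n ≠ ⊤) (ha : Tendsto a atTop (𝓝 0)) :
    Tendsto (fun lam : ℝ≥0 => ∑' n, poissonMeasure (lam * c) {n} * a n) atTop (𝓝 0) := by
  refine ENNReal.tendsto_nhds_zero.2 fun ε hε => ?_
  have hε2 : 0 < ε / 2 := ENNReal.half_pos hε.ne'
  obtain ⟨N, hN⟩ := eventually_atTop.1 (ENNReal.tendsto_nhds_zero.1 ha (ε / 2) hε2)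
  have hfs : Tendsto (fun lam : ℝ≥0 => ∑ n ∈ Finset.range N, poissonMeasure (lam * c) {n} * a n)
      atTop (𝓝 0) := by
    rw [← Finset.sum_const_zero (s := Finset.range N)]
    refine tendsto_finsetSum _ fun n _ => ?_
    have := ENNReal.Tendsto.mul_const (tendsto_poissonMeasure_singleton hc n) (Or.inr (hfin n))
    simpa using this
  filter_upwards [ENNReal.tendsto_nhds_zero.1 hfs (ε / 2) hε2] with lam hlam
  have hone : ∑' n, poissonMeasure (lam * c) {n} = 1 := by
    have := lintegral_countable' (μ := poissonMeasure (lam * c)) fun _ => 1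
    simpa using this.symm
  have hle : ∀ n, poissonMeasure (lam * c) {n} * a n ≤
      (if n ∈ Finset.range N then poissonMeasure (lam * c) {n} * a n else 0) +
        poissonMeasure (lam * c) {n} * (ε / 2) := by
    intro n
    split_ifs with h
    · exact le_self_add
    · rw [zero_add]
      gcongr
      exact hN n (not_lt.1 (Finset.mem_range.not.1 h))
  calc ∑' n, poissonMeasure (lam * c) {n} * a n
      ≤ ∑' n, ((if n ∈ Finset.range N then poissonMeasure (lam * c) {n} * a n else 0) +
        poissonMeasure (lam * c) {n} * (ε / 2)) := ENNReal.tsum_le_tsum hle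
    _ = ∑ n ∈ Finset.range N, poissonMeasure (lam * c) {n} * a n + ε / 2 := by
        rw [ENNReal.tsum_add, ENNReal.tsum_mul_right, hone, one_mul,
          tsum_eq_sum (s := Finset.range N) fun n hn => if_neg hn]
        congr 1
        exact Finset.sum_congr rfl fun n hn => if_pos hn
    _ ≤ ε / 2 + ε / 2 := by gcongr
    _ = ε := ENNReal.add_halves ε

/-! ### The deficit regime, and positivity at density one. -/

namespace Pathloss

variable {d : ℕ} (L : Pathloss d) {F : Measure ℝ} [IsProbabilityMeasure F]

/-- Since `log (1 + s) ≤ s`, the rate is at most the Poisson mixture of mean signal qualities. -/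
theorem tendsto_rate_zero (hd : 1 ≤ d) (hF : F (Set.Iio 0) = 0) (hF' : F (Set.Ioi 0) ≠ 0)
    (hm : ∫⁻ x, ENNReal.ofReal x ∂(L.powerLaw F) < ⊤) {W : ℝ} (hW : 0 < W) :
    Tendsto (L.rate F W) atTop (𝓝 0) := by
  have hμ := L.powerLaw_Iio_zero hF
  have h := tendsto_tsum_poissonMeasure_mul L.volume_domain_toNNReal_pos
    (lintegral_sinrOf_ne_top hμ hm hW)
    (tendsto_lintegral_sinrOf hμ (L.powerLaw_Ioi_zero hd hF') hm hW)
  refine tendsto_of_tendsto_of_tendsto_of_le_of_le tendsto_const_nhds h (fun _ => zero_le)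
    fun lam => ?_
  have h1 := L.lintegral_network F W lam
    (Φ := fun s => ENNReal.ofReal (Real.log (1 + s))) (by fun_prop)
  rw [rate, h1]
  refine ENNReal.tsum_le_tsum fun n => mul_le_mul_right (lintegral_mono_ae ?_) _
  filter_upwards [ae_pi_nonneg hμ n] with p hp
  have h0 := sinrOf_nonneg hW hp
  refine ENNReal.ofReal_le_ofReal ?_
  have := Real.log_le_sub_one_of_pos (by linarith : 0 < 1 + sinrOf W p)
  linarith

theorem tendsto_coverage_zero_of_rate (W : ℝ) (h : Tendsto (L.rate F W) atTop (𝓝 0)) {y : ℝ}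
    (hy : 0 < y) : Tendsto (L.coverage F W y) atTop (𝓝 0) := by
  have hlog : 0 < Real.log (1 + y) := Real.log_pos (by linarith)
  have hc0 : ENNReal.ofReal (Real.log (1 + y)) ≠ 0 := by simpa using hlog
  have h1 : Tendsto (fun lam => (ENNReal.ofReal (Real.log (1 + y)))⁻¹ * L.rate F W lam) atTop
      (𝓝 0) := by
    have := ENNReal.Tendsto.const_mul h (Or.inr (ENNReal.inv_ne_top.2 hc0))
    simpa using this
  have h2 : Tendsto (fun lam => ENNReal.ofReal (L.coverage F W y lam)) atTop (𝓝 0) := by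
    refine tendsto_of_tendsto_of_tendsto_of_le_of_le tendsto_const_nhds h1 (fun _ => zero_le)
      fun lam => ?_
    have h3 := mul_le_mul_right (L.ofReal_log_mul_coverage_le_rate (F := F) W hy lam)
      (ENNReal.ofReal (Real.log (1 + y)))⁻¹
    rwa [← mul_assoc, ENNReal.inv_mul_cancel hc0 ENNReal.ofReal_ne_top, one_mul] at h3
  have h3 := (ENNReal.tendsto_toReal ENNReal.zero_ne_top).comp h2
  refine h3.congr fun lam => ?_
  exact ENNReal.toReal_ofReal measureReal_nonneg

/-- Keep only the event of exactly one node, where there is no interference and the SINR is the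
power over `W`. -/
theorem poisson_one_mul_lintegral_le (W : ℝ) (lam : ℝ≥0) {Φ : ℝ → ℝ≥0∞} (hΦ : Measurable Φ) :
    poissonMeasure (lam * (volume L.domain).toNNReal) {1} *
      ∫⁻ x, Φ (x / W) ∂(L.powerLaw F) ≤ ∫⁻ ω, Φ (L.sinr W ω) ∂(L.network F lam) := by
  rw [L.lintegral_network F W lam hΦ]
  refine le_trans (le_of_eq ?_) (ENNReal.le_tsum 1)
  rw [← lintegral_pi_eval (μ := L.powerLaw F) 1 0 (f := fun x => Φ (x / W)) (by fun_prop)]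
  congr 1
  refine lintegral_congr fun p => ?_
  congr 1
  rw [sinrOf, ciSup_unique]
  simp

theorem poissonMeasure_one_singleton_ne_zero :
    poissonMeasure (1 * (volume L.domain).toNNReal) {1} ≠ 0 := by
  have h := L.volume_domain_toNNReal_pos
  have := poissonMeasure_real_singleton_pos 1 (r := 1 * (volume L.domain).toNNReal) (by simpa using h)
  intro h0
  rw [measureReal_def, h0] at this
  simp at this

theorem coverage_one_pos {W y : ℝ} (hW : 0 < W) (h : L.powerLaw F (Set.Ici (y * W)) ≠ 0) :
    0 < L.coverage F W y 1 := by
  have h1 := L.poisson_one_mul_lintegral_le (F := F) W 1 (Φ := (Set.Ici y).indicator fun _ => 1)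
    (measurable_const.indicator measurableSet_Ici)
  have h2 : ∫⁻ x, (Set.Ici y).indicator (fun _ => (1:ℝ≥0∞)) (x / W) ∂(L.powerLaw F) =
      L.powerLaw F (Set.Ici (y * W)) := by
    rw [← lintegral_indicator_one measurableSet_Ici]
    refine lintegral_congr fun x => ?_
    simp only [Set.indicator_apply, Set.mem_Ici, le_div_iff₀ hW, Pi.one_apply]
  have h3 : ∫⁻ ω, (Set.Ici y).indicator (fun _ => (1:ℝ≥0∞)) (L.sinr W ω) ∂(L.network F 1) =
      L.network F 1 {ω | y ≤ L.sinr W ω} := by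
    rw [← lintegral_indicator_one (measurableSet_le measurable_const (L.measurable_sinr W))]
    rfl
  rw [h2, h3] at h1
  have h4 : L.network F 1 {ω | y ≤ L.sinr W ω} ≠ 0 := fun h0 => by
    rw [h0, nonpos_iff_eq_zero, mul_eq_zero] at h1
    exact h1.elim L.poissonMeasure_one_singleton_ne_zero h
  have : IsProbabilityMeasure (L.network F 1) := by unfold network; infer_instance
  exact ENNReal.toReal_pos h4 (measure_ne_top _ _)

theorem rate_one_pos (hd : 1 ≤ d) (hF' : F (Set.Ioi 0) ≠ 0) {W : ℝ} (hW : 0 < W) :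
    0 < L.rate F W 1 := by
  refine lt_of_lt_of_le (pos_iff_ne_zero.2 ?_) (L.poisson_one_mul_lintegral_le (F := F) W 1
    (Φ := fun s => ENNReal.ofReal (Real.log (1 + s))) (by fun_prop))
  refine mul_ne_zero L.poissonMeasure_one_singleton_ne_zero fun h0 => ?_
  rw [lintegral_eq_zero_iff (by fun_prop)] at h0
  refine L.powerLaw_Ioi_zero hd hF' (measure_mono_null (fun x hx => ?_) h0)
  have hx : 0 < x := hx
  intro h1
  have h2 : Real.log (1 + x / W) ≤ 0 := ENNReal.ofReal_eq_zero.1 h1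
  have h3 : 0 < Real.log (1 + x / W) := Real.log_pos (by
    have : 0 < x / W := by positivity
    linarith)
  linarith

end Pathloss

/-! ### Assembly of the three regimes. -/

theorem tendsto_const_mul_nnreal_atTop {u : ℝ≥0} (hu : 0 < u) :
    Tendsto (fun lam : ℝ≥0 => u * lam) atTop atTop :=
  tendsto_atTop.2 fun b => by
    filter_upwards [eventually_ge_atTop (b / u)] with lam h
    rwa [div_le_iff₀' hu] at h

theorem theorem3 (d : ℕ) (hd : 1 ≤ d) (L : Pathloss d)
    (F : Measure ℝ) [IsProbabilityMeasure F]
    (hF_nonneg : F (Set.Iio 0) = 0) (hF_pos : F (Set.Ioi 0) ≠ 0)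
    (W : ℝ) (hW : 0 < W) (y : ℝ) (hy : 0 < y) :
    -- slowly varying tail: growth
    (RegularlyVarying (tail (L.powerLaw F)) 0 →
      Tendsto (L.coverage F W y) atTop (𝓝 1) ∧ Tendsto (L.rate F W) atTop (𝓝 ⊤)) ∧
    -- regularly varying tail of index in (-1, 0): saturation
    (∀ α : ℝ, 0 < α → α < 1 → RegularlyVarying (tail (L.powerLaw F)) (-α) →
      ∀ u : ℝ≥0, 0 < u →
        Tendsto (fun lam => L.coverage F W y (u * lam) / L.coverage F W y lam) atTop (𝓝 1) ∧
        Tendsto (fun lam => L.rate F W (u * lam) / L.rate F W lam) atTop (𝓝 1)) ∧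
    -- the remaining tails: deficit
    ((∀ α : ℝ, 0 ≤ α → α ≤ 1 → ¬ RegularlyVarying (tail (L.powerLaw F)) (-α)) →
      (ClassifiedTail (L.powerLaw F) ∨ Integrable id (L.powerLaw F)) →
        Tendsto (L.coverage F W y) atTop (𝓝 0) ∧
        Tendsto (L.rate F W) atTop (𝓝 0) ∧
        (L.powerLaw F (Set.Ici (y * W)) ≠ 0 → ∃ lam_p : ℝ≥0, 0 < L.coverage F W y lam_p) ∧
        ∃ lam_c : ℝ≥0, 0 < L.rate F W lam_c) := by
  refine ⟨fun h => ⟨L.tendsto_coverage_of_slowlyVarying hF_nonneg h hW y,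
    L.tendsto_rate_of_slowlyVarying hF_nonneg h hW⟩, fun α hα hα1 h u hu => ⟨?_, ?_⟩,
    fun hnot hcases => ?_⟩
  -- Densities `u * lam` and `lam` share one nonzero finite limit, so the quotient tends to one.
  · obtain ⟨p, hp0, hp⟩ :=
      L.exists_tendsto_coverage_of_regularlyVarying hF_nonneg hα hα1 h hW hy
    have := (hp.comp (tendsto_const_mul_nnreal_atTop hu)).div hp hp0
    rwa [div_self hp0] at this
  · obtain ⟨c, hc0, hct, hc⟩ :=
      L.exists_tendsto_rate_of_regularlyVarying hF_nonneg hα hα1 h hW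
    have := ENNReal.Tendsto.div (hc.comp (tendsto_const_mul_nnreal_atTop hu)) (Or.inl hc0)
      hc (Or.inl hct)
    rwa [ENNReal.div_self hc0 hct] at this
  · have hm := lintegral_ofReal_lt_top_of_classified (L.powerLaw_Iio_zero hF_nonneg) hnot hcases
    have hrate := L.tendsto_rate_zero hd hF_nonneg hF_pos hm hW
    exact ⟨L.tendsto_coverage_zero_of_rate W hrate hy, hrate,
      fun h => ⟨1, L.coverage_one_pos hW h⟩, 1, L.rate_one_pos hd hF_pos hW⟩
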